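/- **Setting.** Let $w\in\mathbb R^n$ with $w_b>0$, $\sum_b w_b=1$, and $R_B>0$. For $R\ge 0$ let $\mathcal L(R)$ be the set of probability distributions $F$ on $\mathbb R_+^n$ with $\mathbb E_{x\sim F}\big[\sum_b x_b\big]\le R$, and for $P\ge0$ let $\Delta_n(P)=\{p\in\mathbb R_+^n:\sum_b p_b=P\}$. For $p\in\mathbb R^n_+$ and independent $x_A\sim F_A$, $x_B\sim F_B$, player $A$'s payoff is $$U_A(p,F_A,F_B)=\mathbb E\Big[\sum_b w_b\big(\mathbb 1\{x_{A,b}+p_b>x_{B,b}\}+\tau_b\mathbb 1\{x_{A,b}+p_b=x_{B,b}\}\big)\Big],\qquad U_B=1-U_A,$$ where $\tau\in[0,1]^n$ is an arbitrary tie-breaking rule ($\tau_b=1$: ties go to $A$; $\tau_b=0$: ties go to $B$). $\text{GL-F}(p,R_A,R_B)$ is the game in which $A$ and $B$ simultaneously choose $F_A\in\mathcal L(R_A)$, $F_B\in\mathcal L(R_B)$ with these payoffs. In the two-stage game $\text{GL-P}(P,R_A,R_B,w)$ player $A$ first chooses $p\in\Delta_n(P)$, which $B$ observes, and then $\text{GL-F}(p,R_A,R_B)$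 is played. A subgame-perfect equilibrium (SPE) is a triple $(p^*,F_A^*(\cdot),F_B^*(\cdot))$ with $p^*\in\Delta_n(P)$ such that $(F_A^*(p),F_B^*(p))$ is a Nash equilibrium of $\text{GL-F}(p,R_A,R_B)$ for every $p\in\Delta_n(P)$, and $U_A(p^*,F_A^*(p^*),F_B^*(p^*))\ge U_A(p,F_A^*(p),F_B^*(p))$ for every $p\in\Delta_n(P)$. **Theorem.** **(I) Second stage.** Let $R_A>0$ and $p\in\mathbb R_+^n$ be arbitrary. For $\kappa_A,\kappa_B>0$ put $\alpha_b=w_b\kappa_A$, $\beta_b=w_b\kappa_B$, $\mathcal B_1=\{b:0<\beta_b-p_b\le\alpha_b\}$, $\mathcal B_2=\{b:\beta_b-p_b>\alpha_b\}$. There exist $\kappa_A,\kappa_B>0$ with $$R_A=\sum_{b\in\mathcal B_1}\frac{(\beta_b-p_b)^2}{2\beta_b}+\sum_{b\in\mathcal B_2}\frac{\alpha_b^2}{2\beta_b},\qquad R_B=\sum_{b\in\mathcal B_1}\frac{\beta_b^2-p_b^2}{2\alpha_b}+\sum_{b\in\mathcal B_2}\frac{(\alpha_b+p_b)^2-p_b^2}{2\alpha_b}.\tag{1}$$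 For every such pair: (a) With $W_j=\sum_{\mathcal B_j}w_b$, $N=\sum_{\mathcal B_1}p_b^2/w_b$, $C_1=R_A+\sum_{\mathcal B_1}p_b$, $C_2=R_B-\sum_{\mathcal B_2}p_b$, $H_1=C_1^2-W_1N$, $H_2=C_2^2+W_2N$, $$\kappa_A=\frac{C_2H_1+C_1\sqrt{H_1H_2}}{W_1C_2^2+W_2C_1^2},\qquad \kappa_B=\frac{C_1H_2+C_2\sqrt{H_1H_2}}{W_1C_2^2+W_2C_1^2}.$$ (b) There are distributions $F_A$ and $F_B$ with the following univariate marginal distribution functions ($t\ge0$; they vanish for $t<0$): $$F_{A,b}(t)=\begin{cases}\min\{1,(t+p_b)/\beta_b\}& b\in\mathcal B_1\\ \min\{1,1-(\alpha_b-t)/\beta_b\}& b\in\mathcal B_2\\ 1&\text{otherwise,}\end{cases}$$ $$F_{B,b}(t)=\begin{cases}1-(\beta_b-p_b)/\alpha_b& b\in\mathcal B_1,\ t<p_b\\ \min\{1,1-(\beta_b-t)/\alpha_b\}& b\in\mathcal B_1,\ t\ge p_b\\ 0& b\in\mathcal B_2,\ t<p_b\\ \min\{1,(t-p_b)/\alpha_b\}&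 b\in\mathcal B_2,\ t\ge p_b\\ 1&\text{otherwise.}\end{cases}$$ Every pair $(F_A,F_B)$ with these marginals is a Nash equilibrium of $\text{GL-F}(p,R_A,R_B)$. (c) In every Nash equilibrium of $\text{GL-F}(p,R_A,R_B)$ player $A$'s payoff is $$\sum_{b\in\mathcal B_1}w_b\Big(1-\frac{\beta_b^2-p_b^2}{2\alpha_b\beta_b}\Big)+\sum_{b\in\mathcal B_2}w_b\frac{\alpha_b}{2\beta_b}+\sum_{b\notin\mathcal B_1\cup\mathcal B_2}w_b .$$ **(II) Two-stage game.** Let $P\ge0$, $R_A\ge0$, and define $\pi_A^*=\pi_A^*(P,R_A,R_B)$ as follows. 1. If $R_A>0$ and either $R_B\le P$, or $R_B>P$ and $R_A\ge\frac{2(R_B-P)^2}{P+2(R_B-P)}$, then $$\pi_A^*=1-\frac{R_B}{2R_A}\left(\frac{R_A+\sqrt{R_A(R_A+2P)}}{P+R_A+\sqrt{R_A(R_A+2P)}}\right)^2 .$$ 2. If $R_B>P$ and $0<R_A<\frac{2(R_B-P)^2}{P+2(R_B-P)}$, then $\pi_A^*=\frac{R_A}{2(R_B-P)}$. 3. If $R_A=0$,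 then $\pi_A^*=1-\min\{1,R_B/P\}$ (which is $0$ for $P=0$). Let $p^*=P\,w$. Then: (a) If $R_A>0$, or $R_A=0$ and ($P<R_B$ or all ties go to $B$), then there is an SPE with pre-allocation $p^*$. (b) If $(F_A^*(p),F_B^*(p))$ is a Nash equilibrium of $\text{GL-F}(p,R_A,R_B)$ for each $p\in\Delta_n(P)$, then $(p^*,F_A^*,F_B^*)$ is an SPE. (c) In every SPE the payoffs of $A$ and $B$ are $\pi_A^*$ and $1-\pi_A^*$. (d) Some $F_A\in\mathcal L(R_A)$ satisfies $U_A(p^*,F_A,F_B)\ge\pi_A^*$ for all $F_B\in\mathcal L(R_B)$; and for every $p\in\Delta_n(P)$ and $\varepsilon>0$ some $F_B\in\mathcal L(R_B)$ satisfies $U_A(p,F_A,F_B)\le\pi_A^*+\varepsilon$ for all $F_A\in\mathcal L(R_A)$. In particular, for $P=0$ and $R_A>0$, $\pi_A^*=\frac{R_A}{2R_B}$ if $R_A<R_B$ and $\pi_A^*=1-\frac{R_B}{2R_A}$ otherwise. -/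

import Mathlib

open MeasureTheory ProbabilityTheory

noncomputable section

namespace Lotto

variable {n : ℕ}

/-- `Δ_n(P)`: nonnegative vectors whose entries sum to `P`. -/
def preallocations (n : ℕ) (P : ℝ) : Set (Fin n → ℝ) :=
  {p | (∀ b, 0 ≤ p b) ∧ ∑ b, p b = P}

/-- `𝓛(R)`: probability distributions on `ℝ₊ⁿ` whose expected total allocation is at most `R`. -/
structure IsStrategy (R : ℝ) (F : Measure (Fin n → ℝ)) : Prop where
  isProbabilityMeasure : IsProbabilityMeasure F
  nonneg : ∀ᵐ x ∂F, ∀ b, 0 ≤ x b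
  budget : ∫⁻ x, ENNReal.ofReal (∑ b, x b) ∂F ≤ ENNReal.ofReal R

/-- The share of a battlefield won by `A`, who holds `a` there (pre-allocated plus real-time
resources) against `x` resources of `B`; `t` is the share of `A` at a tie. The winner indicator
`𝟙{a ≥ x}` is the case `t = 1`. -/
def winShare (t a x : ℝ) : ℝ :=
  if x < a then 1 else if x = a then t else 0

/-- Expected payoff of player `A` (the two allocations are drawn independently). -/
def payoffA (w τ p : Fin n → ℝ) (FA FB : Measure (Fin n → ℝ)) : ℝ :=
  ∫ z, ∑ b, w b * winShare (τ b) (z.1 b + p b) (z.2 b) ∂(FA.prod FB)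

/-- Expected payoff of player `B`. -/
def payoffB (w τ p : Fin n → ℝ) (FA FB : Measure (Fin n → ℝ)) : ℝ :=
  1 - payoffA w τ p FA FB

/-- Nash equilibrium of the General Lotto game with favoritism `GL-F(p, R_A, R_B)`. -/
structure IsNash (w τ p : Fin n → ℝ) (RA RB : ℝ) (FA FB : Measure (Fin n → ℝ)) : Prop where
  strategyA : IsStrategy RA FA
  strategyB : IsStrategy RB FB
  optimalA : ∀ GA, IsStrategy RA GA → payoffA w τ p GA FB ≤ payoffA w τ p FA FB
  optimalB : ∀ GB, IsStrategy RB GB → payoffB w τ p FA GB ≤ payoffB w τ p FA FB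

/-- Subgame-perfect equilibrium of the two-stage game `GL-P(P, R_A, R_B, w)`. -/
structure IsSPE (w τ : Fin n → ℝ) (P RA RB : ℝ) (pstar : Fin n → ℝ)
    (FA FB : (Fin n → ℝ) → Measure (Fin n → ℝ)) : Prop where
  feasible : pstar ∈ preallocations n P
  nash : ∀ p ∈ preallocations n P, IsNash w τ p RA RB (FA p) (FB p)
  optimal : ∀ p ∈ preallocations n P,
    payoffA w τ p (FA p) (FB p) ≤ payoffA w τ pstar (FA pstar) (FB pstar)

/-- Player `A`'s closed-form payoff in the two-stage game: the cases `R_A = 0`,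
`R_B ≤ P` or `R_A ≥ 2(R_B-P)²/(P+2(R_B-P))`, and the remaining one. For `P > 0` the first value
is `1 - min {1, R_B/P}`. -/
def spePayoff (P RA RB : ℝ) : ℝ :=
  if RA = 0 then
    if P ≤ RB then 0 else 1 - RB / P
  else if RB ≤ P ∨ 2 * (RB - P) ^ 2 / (P + 2 * (RB - P)) ≤ RA then
    1 - RB / (2 * RA) *
      ((RA + √(RA * (RA + 2 * P))) / (P + RA + √(RA * (RA + 2 * P)))) ^ 2
  else RA / (2 * (RB - P))

/-! In the definitions below `α = w_b κ_A`, `β = w_b κ_B` and `p = p_b` on one battlefield. It is of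
type 1 if `0 < β - p ≤ α`, of type 2 if `β - p > α`, and uncontested if `β ≤ p`. -/

/-- Cumulative distribution function of `A`'s equilibrium allocation to one battlefield. -/
def marginalA (α β p t : ℝ) : ℝ :=
  if t < 0 then 0
  else if β ≤ p then 1
  else if β - p ≤ α then min 1 ((t + p) / β)
  else min 1 (1 - (α - t) / β)

/-- Cumulative distribution function of `B`'s equilibrium allocation to one battlefield. -/
def marginalB (α β p t : ℝ) : ℝ :=
  if t < 0 then 0
  else if β ≤ p then 1
  else if β - p ≤ α then
    if t < p then 1 - (β - p) / α else min 1 (1 - (β - t) / α)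
  else if t < p then 0 else min 1 ((t - p) / α)

/-- Expected expenditure of `A` on one battlefield. -/
def spendA (α β p : ℝ) : ℝ :=
  if β ≤ p then 0
  else if β - p ≤ α then (β - p) ^ 2 / (2 * β)
  else α ^ 2 / (2 * β)

/-- Expected expenditure of `B` on one battlefield. -/
def spendB (α β p : ℝ) : ℝ :=
  if β ≤ p then 0
  else if β - p ≤ α then (β ^ 2 - p ^ 2) / (2 * α)
  else ((α + p) ^ 2 - p ^ 2) / (2 * α)

/-- Probability that `A` wins one battlefield. -/
def winProbA (α β p : ℝ) : ℝ :=
  if β ≤ p then 1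
  else if β - p ≤ α then 1 - (β ^ 2 - p ^ 2) / (2 * α * β)
  else α / (2 * β)

/-- The system of equations for the positive pair `(κ_A, κ_B)`: both budgets are spent. -/
structure IsKappa (w p : Fin n → ℝ) (RA RB κA κB : ℝ) : Prop where
  posA : 0 < κA
  posB : 0 < κB
  eqA : ∑ b, spendA (w b * κA) (w b * κB) (p b) = RA
  eqB : ∑ b, spendB (w b * κA) (w b * κB) (p b) = RB

/-- `F` is a distribution on `ℝⁿ` with prescribed univariate marginal distribution functions. -/
structure HasMarginals (F : Measure (Fin n → ℝ)) (G : Fin n → ℝ → ℝ) : Prop where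
  isProbabilityMeasure : IsProbabilityMeasure F
  cdf_eq : ∀ b t, cdf (F.map (fun x => x b)) t = G b t

open scoped Classical in
/-- The battlefields of type 1. -/
def type1 (w p : Fin n → ℝ) (κA κB : ℝ) : Finset (Fin n) :=
  Finset.univ.filter fun b => 0 < w b * κB - p b ∧ w b * κB - p b ≤ w b * κA

open scoped Classical in
/-- The battlefields of type 2. -/
def type2 (w p : Fin n → ℝ) (κA κB : ℝ) : Finset (Fin n) :=
  Finset.univ.filter fun b => w b * κA < w b * κB - p b

/-- `C₁ = R_A + P₁`, where `P₁` is the total pre-allocation to `B₁`. -/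
def cOne (p : Fin n → ℝ) (RA : ℝ) (B₁ : Finset (Fin n)) : ℝ := RA + ∑ b ∈ B₁, p b

/-- `C₂ = R_B - P₂`, where `P₂` is the total pre-allocation to `B₂`. -/
def cTwo (p : Fin n → ℝ) (RB : ℝ) (B₂ : Finset (Fin n)) : ℝ := RB - ∑ b ∈ B₂, p b

/-- `H₁ = C₁² - W₁ N₁`, where `W₁ = ∑_{B₁} w_b` and `N₁ = ∑_{B₁} p_b²/w_b`. -/
def hOne (w p : Fin n → ℝ) (RA : ℝ) (B₁ : Finset (Fin n)) : ℝ :=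
  cOne p RA B₁ ^ 2 - (∑ b ∈ B₁, w b) * ∑ b ∈ B₁, p b ^ 2 / w b

/-- `H₂ = C₂² + W₂ N₁`, where `W₂ = ∑_{B₂} w_b` and `N₁ = ∑_{B₁} p_b²/w_b`. -/
def hTwo (w p : Fin n → ℝ) (RB : ℝ) (B₁ B₂ : Finset (Fin n)) : ℝ :=
  cTwo p RB B₂ ^ 2 + (∑ b ∈ B₂, w b) * ∑ b ∈ B₁, p b ^ 2 / w b

/-- `W₁ C₂² + W₂ C₁²`. -/
def kappaDenom (w p : Fin n → ℝ) (RA RB : ℝ) (B₁ B₂ : Finset (Fin n)) : ℝ :=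
  (∑ b ∈ B₁, w b) * cTwo p RB B₂ ^ 2 + (∑ b ∈ B₂, w b) * cOne p RA B₁ ^ 2

/-- Closed form of `κ_A` when `B₁`, `B₂` are the battlefields of types 1 and 2. -/
def kappaA (w p : Fin n → ℝ) (RA RB : ℝ) (B₁ B₂ : Finset (Fin n)) : ℝ :=
  (cTwo p RB B₂ * hOne w p RA B₁ + cOne p RA B₁ * √(hOne w p RA B₁ * hTwo w p RB B₁ B₂)) /
    kappaDenom w p RA RB B₁ B₂

/-- Closed form of `κ_B` when `B₁`, `B₂` are the battlefields of types 1 and 2. -/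
def kappaB (w p : Fin n → ℝ) (RA RB : ℝ) (B₁ B₂ : Finset (Fin n)) : ℝ :=
  (cOne p RA B₁ * hTwo w p RB B₁ B₂ + cTwo p RB B₂ * √(hOne w p RA B₁ * hTwo w p RB B₁ B₂)) /
    kappaDenom w p RA RB B₁ B₂

end Lotto

end

/-!
Against a player with a mean budget, any affine bound on the probability of winning a battlefield
integrates to a bound on the payoff. A player who, with a fixed probability, adds a uniform bid to
a fixed one makes the opponent's winning probability an affine function of the opponent's bid,
except where a trivial bound takes over. With multipliers `κ_A`, `κ_B` for which both budgets are
spent, these laws give matching guarantees of the two players, so the second stage has a value.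

For the proportional pre-allocation `P w` all battlefields are scaled copies of one, and the value
is explicit. The same laws with that `κ_A` and a single bidding probability cost `B` an amount that
depends only on `∑ b, p b`, so `B` holds `A` down to this value whatever the pre-allocation is.
-/

noncomputable section

namespace Lotto

variable {n : ℕ}

/-! ### A single battlefield -/

lemma winShare_nonneg {t a x : ℝ} (ht : 0 ≤ t) : 0 ≤ winShare t a x := by
  unfold winShare
  split_ifs <;> linarith

lemma norm_winShare_le (t a x : ℝ) : ‖winShare t a x‖ ≤ max 1 ‖t‖ := by
  unfold winShare
  split_ifs <;> simp

lemma indicator_Ioi_le_winShare {t : ℝ} (ht : 0 ≤ t) (p x y : ℝ) :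
    (Set.Ioi (y - p)).indicator 1 x ≤ winShare t (x + p) y := by
  simp only [Set.indicator_apply, Set.mem_Ioi, sub_lt_iff_lt_add, Pi.one_apply]
  split_ifs with h
  · simp [winShare, h]
  · exact winShare_nonneg ht

lemma winShare_le_indicator_Iic {t : ℝ} (ht : t ≤ 1) (a y : ℝ) :
    winShare t a y ≤ (Set.Iic a).indicator 1 y := by
  simp only [Set.indicator_apply, Set.mem_Iic, Pi.one_apply, winShare]
  split_ifs <;> linarith

lemma measurable_winShare (t : ℝ) : Measurable fun z : ℝ × ℝ => winShare t z.1 z.2 :=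
  Measurable.ite (measurableSet_lt measurable_snd measurable_fst) measurable_const
    (Measurable.ite (measurableSet_eq_fun measurable_snd measurable_fst) measurable_const
      measurable_const)

lemma integrable_winShare {Ω : Type*} [MeasurableSpace Ω] {μ : Measure Ω} [IsFiniteMeasure μ]
    (t : ℝ) {f g : Ω → ℝ} (hf : Measurable f) (hg : Measurable g) :
    Integrable (fun z => winShare t (f z) (g z)) μ :=
  .of_bound ((measurable_winShare t).comp (hf.prodMk hg)).aestronglyMeasurable _
    (.of_forall fun _ => norm_winShare_le _ _ _)

/-- Expected share of one battlefield won by `A` when `A` holds a pre-allocation `p` there and the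
real-time allocations of `A` and `B` are independent with laws `μ` and `ν`; ties are broken as in
`winShare`. -/
def expectedShare (t p : ℝ) (μ ν : Measure ℝ) : ℝ :=
  ∫ z, winShare t (z.1 + p) z.2 ∂(μ.prod ν)

section expectedShare

variable {t p c β : ℝ} {μ ν : Measure ℝ} [IsProbabilityMeasure μ] [IsProbabilityMeasure ν]

lemma sub_div_le_expectedShare (ht : 0 ≤ t) (hν : ∀ᵐ y ∂ν, 0 ≤ y)
    (hint : Integrable (fun y => y) ν)
    (h : ∀ y, 0 ≤ y → c - y / β ≤ μ.real (Set.Ioi (y - p))) :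
    c - (∫ y, y ∂ν) / β ≤ expectedShare t p μ ν := by
  have hshare : Integrable (fun z : ℝ × ℝ => winShare t (z.1 + p) z.2) (μ.prod ν) :=
    integrable_winShare t (by fun_prop) measurable_snd
  calc c - (∫ y, y ∂ν) / β = ∫ y, (c - y / β) ∂ν := by
        rw [integral_sub (integrable_const c) (hint.div_const β), integral_div]
        simp
    _ ≤ ∫ y, ∫ x, winShare t (x + p) y ∂μ ∂ν := by
        refine integral_mono_ae ((integrable_const c).sub (hint.div_const β))
          hshare.integral_prod_right ?_
        filter_upwards [hν] with y hy
        refine (h y hy).trans ?_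
        rw [← integral_indicator_one measurableSet_Ioi]
        exact integral_mono ((integrable_const 1).indicator measurableSet_Ioi)
          (integrable_winShare t (by fun_prop) measurable_const)
          fun x => indicator_Ioi_le_winShare ht p x y
    _ = expectedShare t p μ ν := (integral_prod_symm _ hshare).symm

lemma expectedShare_le_add_div (ht : t ≤ 1) (hμ : ∀ᵐ x ∂μ, 0 ≤ x)
    (hint : Integrable (fun x => x) μ)
    (h : ∀ x, 0 ≤ x → ν.real (Set.Iic (x + p)) ≤ c + x / β) :
    expectedShare t p μ ν ≤ c + (∫ x, x ∂μ) / β := by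
  have hshare : Integrable (fun z : ℝ × ℝ => winShare t (z.1 + p) z.2) (μ.prod ν) :=
    integrable_winShare t (by fun_prop) measurable_snd
  calc expectedShare t p μ ν = ∫ x, ∫ y, winShare t (x + p) y ∂ν ∂μ := integral_prod _ hshare
    _ ≤ ∫ x, (c + x / β) ∂μ := by
        refine integral_mono_ae hshare.integral_prod_left
          ((integrable_const c).add (hint.div_const β)) ?_
        filter_upwards [hμ] with x hx
        refine le_trans ?_ (h x hx)
        rw [← integral_indicator_one measurableSet_Iic]
        exact integral_mono (integrable_winShare t measurable_const measurable_id)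
          ((integrable_const 1).indicator measurableSet_Iic)
          fun y => winShare_le_indicator_Iic ht (x + p) y
    _ = c + (∫ x, x ∂μ) / β := by
        rw [integral_add (integrable_const c) (hint.div_const β), integral_div]
        simp

lemma expectedShare_dirac_zero :
    expectedShare 0 p (Measure.dirac 0) ν = 1 - ν.real (Set.Ici p) := by
  have hshare : Integrable (fun z : ℝ × ℝ => winShare 0 (z.1 + p) z.2)
      ((Measure.dirac 0).prod ν) := integrable_winShare 0 (by fun_prop) measurable_snd
  have hind (y : ℝ) : winShare 0 p y = (Set.Ici p)ᶜ.indicator 1 y := by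
    simp [winShare, Set.indicator_apply]
  rw [expectedShare, integral_prod _ hshare, integral_dirac]
  simp only [zero_add, hind]
  rw [integral_indicator_one measurableSet_Ici.compl, probReal_compl_eq_one_sub measurableSet_Ici]

end expectedShare

/-! ### Marginals of strategies -/

/-- The law of the allocation to battlefield `b` under the joint distribution `F`. -/
abbrev marginal (F : Measure (Fin n → ℝ)) (b : Fin n) : Measure ℝ := F.map fun x => x b

instance isProbabilityMeasure_marginal {F : Measure (Fin n → ℝ)} [IsProbabilityMeasure F]
    (b : Fin n) : IsProbabilityMeasure (marginal F b) :=
  Measure.isProbabilityMeasure_map (measurable_pi_apply b).aemeasurable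

lemma marginal_pi (μ : Fin n → Measure ℝ) [∀ b, IsProbabilityMeasure (μ b)] (b : Fin n) :
    marginal (Measure.pi μ) b = μ b :=
  (measurePreserving_eval μ b).map_eq

lemma HasMarginals.marginal_eq {F : Measure (Fin n → ℝ)} {G : Fin n → ℝ → ℝ}
    (h : HasMarginals F G) {b : Fin n} {μ : Measure ℝ} [IsProbabilityMeasure μ]
    (hμ : ∀ t, cdf μ t = G b t) : marginal F b = μ := by
  have := h.isProbabilityMeasure
  refine Measure.eq_of_cdf _ _ (StieltjesFunction.ext fun t => ?_)
  rw [h.cdf_eq, hμ]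

lemma exists_hasMarginals {G : Fin n → ℝ → ℝ} {μ : Fin n → Measure ℝ}
    [∀ b, IsProbabilityMeasure (μ b)] (hμ : ∀ b t, cdf (μ b) t = G b t) :
    ∃ F, HasMarginals F G :=
  ⟨Measure.pi μ, inferInstance, fun b t =>
    (congrArg (fun ν => cdf ν t) (marginal_pi μ b)).trans (hμ b t)⟩

lemma payoffA_eq_sum_expectedShare (w τ p : Fin n → ℝ) (FA FB : Measure (Fin n → ℝ))
    [IsProbabilityMeasure FA] [IsProbabilityMeasure FB] :
    payoffA w τ p FA FB =
      ∑ b, w b * expectedShare (τ b) (p b) (marginal FA b) (marginal FB b) := by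
  rw [payoffA, integral_finsetSum _ fun b _ =>
    (integrable_winShare (τ b) (by fun_prop) (by fun_prop)).const_mul (w b)]
  refine Finset.sum_congr rfl fun b _ => ?_
  have hmeas : Measurable fun z : ℝ × ℝ => winShare (τ b) (z.1 + p b) z.2 :=
    (measurable_winShare (τ b)).comp (by fun_prop : Measurable fun z : ℝ × ℝ => (z.1 + p b, z.2))
  rw [integral_const_mul, expectedShare,
    Measure.map_prod_map _ _ (measurable_pi_apply b) (measurable_pi_apply b),
    integral_map (by fun_prop) hmeas.aestronglyMeasurable]
  rfl

lemma isStrategy_iff_marginal {R : ℝ} {F : Measure (Fin n → ℝ)} [IsProbabilityMeasure F] :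
    IsStrategy R F ↔ (∀ b, ∀ᵐ t ∂marginal F b, 0 ≤ t) ∧
      ∑ b, ∫⁻ t, ENNReal.ofReal t ∂marginal F b ≤ ENNReal.ofReal R := by
  have hnonneg : (∀ᵐ x ∂F, ∀ b, 0 ≤ x b) ↔ ∀ b, ∀ᵐ t ∂marginal F b, 0 ≤ t := by
    rw [ae_all_iff]
    exact forall_congr' fun b =>
      (ae_map_iff (measurable_pi_apply b).aemeasurable measurableSet_Ici).symm
  have hsum (h : ∀ᵐ x ∂F, ∀ b, 0 ≤ x b) : ∫⁻ x, ENNReal.ofReal (∑ b, x b) ∂F =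
      ∑ b, ∫⁻ t, ENNReal.ofReal t ∂marginal F b := by
    have hmap (b : Fin n) :=
      lintegral_map (μ := F) ENNReal.measurable_ofReal (measurable_pi_apply b)
    simp only [hmap]
    rw [← lintegral_finsetSum _ fun b _ => by fun_prop]
    refine lintegral_congr_ae ?_
    filter_upwards [h] with x hx
    exact ENNReal.ofReal_sum_of_nonneg fun b _ => hx b
  rw [← hnonneg]
  exact ⟨fun h => ⟨h.nonneg, hsum h.nonneg ▸ h.budget⟩,
    fun h => ⟨inferInstance, h.1, (hsum h.1).symm ▸ h.2⟩⟩

section IsStrategy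

variable {R : ℝ} {F : Measure (Fin n → ℝ)}

lemma IsStrategy.marginal_nonneg (h : IsStrategy R F) (b : Fin n) :
    ∀ᵐ t ∂marginal F b, 0 ≤ t :=
  have := h.isProbabilityMeasure
  (isStrategy_iff_marginal.1 h).1 b

lemma IsStrategy.integrable_marginal (h : IsStrategy R F) (b : Fin n) :
    Integrable (fun t => t) (marginal F b) := by
  have := h.isProbabilityMeasure
  have hle : ∫⁻ t, ENNReal.ofReal t ∂marginal F b ≤ ENNReal.ofReal R :=
    (Finset.single_le_sum (fun _ _ => zero_le) (Finset.mem_univ b)).trans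
      (isStrategy_iff_marginal.1 h).2
  exact ⟨aestronglyMeasurable_id, (hasFiniteIntegral_iff_ofReal (h.marginal_nonneg b)).2
    (hle.trans_lt ENNReal.ofReal_lt_top)⟩

lemma IsStrategy.sum_integral_marginal_le (h : IsStrategy R F) (hR : 0 ≤ R) :
    ∑ b, ∫ t, t ∂marginal F b ≤ R := by
  have := h.isProbabilityMeasure
  refine (ENNReal.ofReal_le_ofReal_iff hR).1 ?_
  rw [ENNReal.ofReal_sum_of_nonneg fun b _ => integral_nonneg_of_ae (h.marginal_nonneg b)]
  simp only [ofReal_integral_eq_lintegral_ofReal (h.integrable_marginal _) (h.marginal_nonneg _)]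
  exact (isStrategy_iff_marginal.1 h).2

end IsStrategy

section guarantees

variable {w τ p c : Fin n → ℝ} {κ RA RB : ℝ} {FA FB : Measure (Fin n → ℝ)}

lemma payoffA_nonneg (hw : ∀ b, 0 ≤ w b) (hτ : ∀ b, 0 ≤ τ b) : 0 ≤ payoffA w τ p FA FB :=
  integral_nonneg fun _ => Finset.sum_nonneg fun b _ =>
    mul_nonneg (hw b) (winShare_nonneg (hτ b))

lemma sum_sub_div_le_payoffA [IsProbabilityMeasure FA] (hw : ∀ b, 0 < w b) (hτ : ∀ b, 0 ≤ τ b)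
    (hκ : 0 < κ) (hRB : 0 ≤ RB) (hFB : IsStrategy RB FB)
    (h : ∀ b y, 0 ≤ y → c b - y / (w b * κ) ≤ (marginal FA b).real (Set.Ioi (y - p b))) :
    ∑ b, w b * c b - RB / κ ≤ payoffA w τ p FA FB := by
  have := hFB.isProbabilityMeasure
  calc ∑ b, w b * c b - RB / κ ≤ ∑ b, w b * c b - (∑ b, ∫ y, y ∂marginal FB b) / κ := by
        gcongr
        exact hFB.sum_integral_marginal_le hRB
    _ = ∑ b, w b * (c b - (∫ y, y ∂marginal FB b) / (w b * κ)) := by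
        rw [Finset.sum_div, ← Finset.sum_sub_distrib]
        refine Finset.sum_congr rfl fun b _ => ?_
        have := (hw b).ne'
        field_simp
    _ ≤ payoffA w τ p FA FB := by
        rw [payoffA_eq_sum_expectedShare]
        exact Finset.sum_le_sum fun b _ => mul_le_mul_of_nonneg_left (sub_div_le_expectedShare
          (hτ b) (hFB.marginal_nonneg b) (hFB.integrable_marginal b) (h b)) (hw b).le

lemma payoffA_le_sum_add_div [IsProbabilityMeasure FB] (hw : ∀ b, 0 < w b) (hτ : ∀ b, τ b ≤ 1)
    (hκ : 0 < κ) (hRA : 0 ≤ RA) (hFA : IsStrategy RA FA)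
    (h : ∀ b x, 0 ≤ x → (marginal FB b).real (Set.Iic (x + p b)) ≤ c b + x / (w b * κ)) :
    payoffA w τ p FA FB ≤ ∑ b, w b * c b + RA / κ := by
  have := hFA.isProbabilityMeasure
  calc payoffA w τ p FA FB ≤ ∑ b, w b * (c b + (∫ x, x ∂marginal FA b) / (w b * κ)) := by
        rw [payoffA_eq_sum_expectedShare]
        exact Finset.sum_le_sum fun b _ => mul_le_mul_of_nonneg_left (expectedShare_le_add_div
          (hτ b) (hFA.marginal_nonneg b) (hFA.integrable_marginal b) (h b)) (hw b).le
    _ = ∑ b, w b * c b + (∑ b, ∫ x, x ∂marginal FA b) / κ := by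
        rw [Finset.sum_div, ← Finset.sum_add_distrib]
        refine Finset.sum_congr rfl fun b _ => ?_
        have := (hw b).ne'
        field_simp
    _ ≤ ∑ b, w b * c b + RA / κ := by
        gcongr
        exact hFA.sum_integral_marginal_le hRA

end guarantees

/-! ### Ramp laws -/

/-- The law that is uniform on `[p, p + c * γ]` with probability `c` and puts the remaining mass
`1 - c` at `0`. As an image of the uniform law on `(0, 1]` it makes sense for `γ = 0` too, where it
is the two-point law on `{0, p}`. -/
def rampLaw (c p γ : ℝ) : Measure ℝ :=
  (volume.restrict (Set.Ioc 0 1)).map fun u => if u ≤ c then p + γ * u else 0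

section rampLaw

variable {c p γ t x : ℝ}

lemma measurable_ramp (c p γ : ℝ) : Measurable fun u : ℝ => if u ≤ c then p + γ * u else 0 :=
  Measurable.ite measurableSet_Iic (by fun_prop) measurable_const

instance isProbabilityMeasure_rampLaw : IsProbabilityMeasure (rampLaw c p γ) :=
  have : IsProbabilityMeasure (volume.restrict (Set.Ioc (0 : ℝ) 1)) := ⟨by simp⟩
  Measure.isProbabilityMeasure_map (measurable_ramp c p γ).aemeasurable

lemma rampLaw_real_apply {s : Set ℝ} (hs : MeasurableSet s) :
    (rampLaw c p γ).real s =
      volume.real ({u | (if u ≤ c then p + γ * u else 0) ∈ s} ∩ Set.Ioc (0 : ℝ) 1) := by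
  rw [rampLaw, map_measureReal_apply (measurable_ramp c p γ) hs,
    measureReal_restrict_apply (measurable_ramp c p γ hs)]
  rfl

lemma rampLaw_nonneg (hp : 0 ≤ p) (hγ : 0 ≤ γ) : ∀ᵐ t ∂rampLaw c p γ, 0 ≤ t := by
  refine (ae_map_iff (measurable_ramp c p γ).aemeasurable measurableSet_Ici).2 ?_
  filter_upwards [ae_restrict_mem measurableSet_Ioc] with u hu
  have := mul_nonneg hγ hu.1.le
  split_ifs <;> positivity

lemma lintegral_rampLaw (hc : 0 ≤ c) (hc1 : c ≤ 1) (hp : 0 ≤ p) (hγ : 0 ≤ γ) :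
    ∫⁻ t, ENNReal.ofReal t ∂rampLaw c p γ = ENNReal.ofReal (c * p + c ^ 2 * γ / 2) := by
  have hind (u : ℝ) : ENNReal.ofReal (if u ≤ c then p + γ * u else 0) =
      (Set.Iic c).indicator (fun u => ENNReal.ofReal (p + γ * u)) u := by
    simp only [Set.indicator_apply, Set.mem_Iic]
    split_ifs <;> simp
  have hpos : 0 ≤ᵐ[volume.restrict (Set.Ioc 0 c)] fun u => p + γ * u := by
    filter_upwards [ae_restrict_mem measurableSet_Ioc] with u hu
    exact add_nonneg hp (mul_nonneg hγ hu.1.le)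
  rw [rampLaw, lintegral_map ENNReal.measurable_ofReal (measurable_ramp c p γ)]
  simp only [hind]
  rw [lintegral_indicator measurableSet_Iic, Measure.restrict_restrict measurableSet_Iic,
    Set.inter_comm, Set.Ioc_inter_Iic, min_eq_right hc1, ← ofReal_integral_eq_lintegral_ofReal
      (ContinuousOn.integrableOn_Icc (by fun_prop) |>.mono_set Set.Ioc_subset_Icc_self) hpos,
    ← intervalIntegral.integral_of_le hc, intervalIntegral.integral_add
      (f := fun _ => p) (g := fun u => γ * u) (by simp)
        (Continuous.intervalIntegrable (by fun_prop) _ _),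
    intervalIntegral.integral_const, intervalIntegral.integral_const_mul, integral_id, smul_eq_mul]
  congr 1
  ring

lemma rampLaw_real_Ioi (hc : c ≤ 1) (hγ : 0 < γ) (ht : 0 ≤ t) :
    (rampLaw c p γ).real (Set.Ioi t) = max (c - max 0 ((t - p) / γ)) 0 := by
  have hset : {u | (if u ≤ c then p + γ * u else 0) ∈ Set.Ioi t} ∩ Set.Ioc 0 1 =
      Set.Ioc (max 0 ((t - p) / γ)) c := by
    ext u
    simp only [Set.mem_inter_iff, Set.mem_ofPred_eq, Set.mem_Ioi, Set.mem_Ioc, max_lt_iff,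
      div_lt_iff₀ hγ]
    split_ifs with hu
    · grind
    · grind
  rw [rampLaw_real_apply measurableSet_Ioi, hset, Real.volume_real_Ioc]

lemma rampLaw_real_Ioi_of_neg (hp : 0 ≤ p) (hγ : 0 ≤ γ) (ht : t < 0) :
    (rampLaw c p γ).real (Set.Ioi t) = 1 := by
  have hae : Set.Ioi t ∈ ae (rampLaw c p γ) := by
    filter_upwards [rampLaw_nonneg hp hγ] with u hu using ht.trans_le hu
  rw [measureReal_def, (mem_ae_iff_prob_eq_one measurableSet_Ioi).1 hae, ENNReal.toReal_one]

lemma cdf_rampLaw_of_neg (hp : 0 ≤ p) (hγ : 0 ≤ γ) (ht : t < 0) : cdf (rampLaw c p γ) t = 0 := by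
  rw [cdf_eq_real, ← Set.compl_Ioi, probReal_compl_eq_one_sub measurableSet_Ioi,
    rampLaw_real_Ioi_of_neg hp hγ ht, sub_self]

lemma cdf_rampLaw (hc : c ≤ 1) (hγ : 0 < γ) (ht : 0 ≤ t) :
    cdf (rampLaw c p γ) t = 1 - max (c - max 0 ((t - p) / γ)) 0 := by
  rw [cdf_eq_real, ← Set.compl_Ioi, probReal_compl_eq_one_sub measurableSet_Ioi,
    rampLaw_real_Ioi hc hγ ht]

lemma rampLaw_real_Iic_le (hc : c ≤ 1) (hp : 0 ≤ p) (hγ : 0 < γ) (hx : 0 ≤ x) :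
    (rampLaw c p γ).real (Set.Iic (x + p)) ≤ 1 - c + x / γ := by
  rw [← cdf_eq_real, cdf_rampLaw hc hγ (add_nonneg hx hp), add_sub_cancel_right,
    max_eq_right (div_nonneg hx hγ.le)]
  linarith [le_max_left (c - x / γ) 0]

lemma le_rampLaw_real_Ici (hc : c ≤ 1) (hγ : 0 ≤ γ) : c ≤ (rampLaw c p γ).real (Set.Ici p) := by
  have hsub : Set.Ioc 0 c ⊆
      {u | (if u ≤ c then p + γ * u else 0) ∈ Set.Ici p} ∩ Set.Ioc (0 : ℝ) 1 := fun u hu =>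
    ⟨by simp [hu.2, mul_nonneg hγ hu.1.le], hu.1, hu.2.trans hc⟩
  rw [rampLaw_real_apply measurableSet_Ici]
  calc c ≤ volume.real (Set.Ioc 0 c) := by simp [Real.volume_real_Ioc]
    _ ≤ _ := measureReal_mono hsub (measure_inter_lt_top_of_right_ne_top (by simp)).ne

end rampLaw

lemma isStrategy_of_marginal_eq_rampLaw {c p γ : Fin n → ℝ} {R : ℝ} {F : Measure (Fin n → ℝ)}
    [IsProbabilityMeasure F] (hF : ∀ b, marginal F b = rampLaw (c b) (p b) (γ b))
    (hc : ∀ b, 0 ≤ c b) (hc1 : ∀ b, c b ≤ 1) (hp : ∀ b, 0 ≤ p b) (hγ : ∀ b, 0 ≤ γ b)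
    (hR : ∑ b, (c b * p b + c b ^ 2 * γ b / 2) ≤ R) : IsStrategy R F := by
  rw [isStrategy_iff_marginal]
  refine ⟨fun b => hF b ▸ rampLaw_nonneg (hp b) (hγ b), ?_⟩
  calc ∑ b, ∫⁻ t, ENNReal.ofReal t ∂marginal F b
      = ∑ b, ENNReal.ofReal (c b * p b + c b ^ 2 * γ b / 2) :=
        Finset.sum_congr rfl fun b _ => by
          rw [hF, lintegral_rampLaw (hc b) (hc1 b) (hp b) (hγ b)]
    _ = ENNReal.ofReal (∑ b, (c b * p b + c b ^ 2 * γ b / 2)) :=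
        (ENNReal.ofReal_sum_of_nonneg fun b _ => add_nonneg (mul_nonneg (hc b) (hp b))
          (div_nonneg (mul_nonneg (sq_nonneg _) (hγ b)) zero_le_two)).symm
    _ ≤ ENNReal.ofReal R := ENNReal.ofReal_le_ofReal hR

/-! ### Equilibrium play on one battlefield -/

/-- The amount `min (max 0 (β - p)) α` by which the bids exceed the pre-allocation on one
battlefield: in equilibrium `A` bids uniformly on `[0, contested α β p]` with probability
`contested α β p / β`, and `B` bids `p` more than that with probability `contested α β p / α`. -/
def contested (α β p : ℝ) : ℝ := min (max 0 (β - p)) α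

section contested

variable {α β p s x y : ℝ}

lemma contested_of_le (hα : 0 < α) (h : β ≤ p) : contested α β p = 0 := by
  rw [contested, max_eq_left (by linarith), min_eq_left hα.le]

lemma contested_of_type1 (h : p < β) (h' : β - p ≤ α) : contested α β p = β - p := by
  rw [contested, max_eq_right (by linarith), min_eq_left h']

lemma contested_of_type2 (hα : 0 < α) (h : α < β - p) : contested α β p = α := by
  rw [contested, max_eq_right (by linarith), min_eq_right h.le]

lemma contested_nonneg (hα : 0 < α) : 0 ≤ contested α β p := le_min (le_max_left _ _) hα.le

lemma contested_le_left : contested α β p ≤ α := min_le_right _ _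

lemma contested_le_right (hβ : 0 < β) (hp : 0 ≤ p) : contested α β p ≤ β :=
  (min_le_left _ _).trans (max_le hβ.le (by linarith))

lemma spendA_eq (hα : 0 < α) : spendA α β p = contested α β p ^ 2 / (2 * β) := by
  unfold spendA
  split_ifs with h1 h2
  · simp [contested_of_le hα h1]
  · rw [contested_of_type1 (not_le.1 h1) h2]
  · rw [contested_of_type2 hα (not_le.1 h2)]

lemma spendB_eq (hα : 0 < α) :
    spendB α β p = contested α β p * (contested α β p + 2 * p) / (2 * α) := by
  unfold spendB
  split_ifs with h1 h2
  · simp [contested_of_le hα h1]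
  · rw [contested_of_type1 (not_le.1 h1) h2]
    ring
  · rw [contested_of_type2 hα (not_le.1 h2)]
    ring

lemma winProbA_sub_spendA_div (hα : 0 < α) (hβ : 0 < β) :
    winProbA α β p - spendA α β p / α = 1 - contested α β p / α := by
  rw [spendA_eq hα]
  unfold winProbA
  split_ifs with h1 h2
  · simp [contested_of_le hα h1]
  · rw [contested_of_type1 (not_le.1 h1) h2]
    field_simp
    ring
  · rw [contested_of_type2 hα (not_le.1 h2)]
    field_simp
    ring

lemma winProbA_add_spendB_div (hα : 0 < α) (hβ : 0 < β) :
    winProbA α β p + spendB α β p / β = min 1 ((α + p) / β) := by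
  unfold winProbA spendB
  split_ifs with h1 h2
  · rw [min_eq_left ((one_le_div hβ).2 (by linarith)), zero_div, add_zero]
  · rw [min_eq_left ((one_le_div hβ).2 (by linarith))]
    field_simp
    ring
  · rw [min_eq_right ((div_le_one hβ).2 (by linarith))]
    field_simp
    ring

/-- The law of `A`'s equilibrium allocation to one battlefield, with distribution function
`marginalA α β p`. -/
def equilibriumLawA (α β p : ℝ) : Measure ℝ := rampLaw (contested α β p / β) 0 β

/-- The law of `B`'s equilibrium allocation to one battlefield, with distribution function
`marginalB α β p`. -/
def equilibriumLawB (α β p : ℝ) : Measure ℝ := rampLaw (contested α β p / α) p α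

instance isProbabilityMeasure_equilibriumLawA : IsProbabilityMeasure (equilibriumLawA α β p) :=
  isProbabilityMeasure_rampLaw

instance isProbabilityMeasure_equilibriumLawB : IsProbabilityMeasure (equilibriumLawB α β p) :=
  isProbabilityMeasure_rampLaw

lemma contested_div_left_le_one (hα : 0 < α) : contested α β p / α ≤ 1 :=
  (div_le_one hα).2 contested_le_left

lemma contested_div_right_le_one (hβ : 0 < β) (hp : 0 ≤ p) : contested α β p / β ≤ 1 :=
  (div_le_one hβ).2 (contested_le_right hβ hp)

lemma cdf_equilibriumLawA (hα : 0 < α) (hβ : 0 < β) (hp : 0 ≤ p) (t : ℝ) :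
    cdf (equilibriumLawA α β p) t = marginalA α β p t := by
  rcases lt_or_ge t 0 with ht | ht
  · rw [equilibriumLawA, cdf_rampLaw_of_neg le_rfl hβ.le ht, marginalA, if_pos ht]
  have ht' : 0 ≤ t / β := div_nonneg ht hβ.le
  rw [equilibriumLawA, cdf_rampLaw (contested_div_right_le_one hβ hp) hβ ht, sub_zero,
    max_eq_right ht', ← min_sub_sub_left, sub_zero, min_comm]
  unfold marginalA
  rw [if_neg ht.not_gt]
  split_ifs with h1 h2
  · simp [contested_of_le hα h1, ht']
  · rw [contested_of_type1 (not_le.1 h1) h2]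
    congr 1
    field_simp
    ring
  · rw [contested_of_type2 hα (not_le.1 h2), sub_div]

lemma cdf_equilibriumLawB (hα : 0 < α) (hp : 0 ≤ p) (t : ℝ) :
    cdf (equilibriumLawB α β p) t = marginalB α β p t := by
  rcases lt_or_ge t 0 with ht | ht
  · rw [equilibriumLawB, cdf_rampLaw_of_neg hp hα.le ht, marginalB, if_pos ht]
  rw [equilibriumLawB, cdf_rampLaw (contested_div_left_le_one hα) hα ht]
  have hlow (h : t < p) : max 0 ((t - p) / α) = 0 :=
    max_eq_left (div_nonpos_of_nonpos_of_nonneg (by linarith) hα.le)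
  have hhigh (h : p ≤ t) : max 0 ((t - p) / α) = (t - p) / α :=
    max_eq_right (div_nonneg (by linarith) hα.le)
  unfold marginalB
  rw [if_neg ht.not_gt]
  split_ifs with h1 h2 h3 h3
  · simp [contested_of_le hα h1]
  · rw [contested_of_type1 (not_le.1 h1) h2, hlow h3, sub_zero,
      max_eq_left (div_nonneg (by linarith) hα.le)]
  · rw [contested_of_type1 (not_le.1 h1) h2, hhigh (not_lt.1 h3), ← min_sub_sub_left, sub_zero,
      min_comm, ← sub_div, sub_sub_sub_cancel_right]
  · rw [contested_of_type2 hα (not_le.1 h2), hlow h3, div_self hα.ne', sub_zero,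
      max_eq_left zero_le_one, sub_self]
  · rw [contested_of_type2 hα (not_le.1 h2), hhigh (not_lt.1 h3), div_self hα.ne',
      ← min_sub_sub_left, sub_zero, sub_sub_cancel, min_comm]

lemma sub_div_le_equilibriumLawA_real_Ioi (hβ : 0 < β) (hp : 0 ≤ p) (hy : 0 ≤ y) :
    min 1 ((α + p) / β) - y / β ≤ (equilibriumLawA α β p).real (Set.Ioi (y - p)) := by
  rw [equilibriumLawA]
  rcases lt_or_ge y p with hyp | hpy
  · rw [rampLaw_real_Ioi_of_neg le_rfl hβ.le (sub_neg.2 hyp)]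
    linarith [min_le_left 1 ((α + p) / β), div_nonneg hy hβ.le]
  have hbid : min β (α + p) - y ≤ max (contested α β p - (y - p)) 0 := by
    unfold contested
    grind
  rw [rampLaw_real_Ioi (contested_div_right_le_one hβ hp) hβ (sub_nonneg.2 hpy), sub_zero,
    max_eq_right (div_nonneg (sub_nonneg.2 hpy) hβ.le), ← sub_div, ← zero_div β,
    max_div_div_right hβ.le, ← div_self hβ.ne', min_div_div_right hβ.le, ← sub_div]
  gcongr

lemma equilibriumLawB_real_Iic_le (hα : 0 < α) (hp : 0 ≤ p) (hx : 0 ≤ x) :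
    (equilibriumLawB α β p).real (Set.Iic (x + p)) ≤ 1 - contested α β p / α + x / α :=
  rampLaw_real_Iic_le (contested_div_left_le_one hα) hp hα hx

lemma contested_mul (hs : 0 < s) : contested (s * α) (s * β) (s * p) = s * contested α β p := by
  rw [contested, contested, ← mul_sub, ← mul_zero s, ← mul_max_of_nonneg _ _ hs.le,
    ← mul_min_of_nonneg _ _ hs.le, mul_zero]

lemma spendA_mul (hs : 0 < s) (hα : 0 < α) :
    spendA (s * α) (s * β) (s * p) = s * spendA α β p := by
  rw [spendA_eq (mul_pos hs hα), spendA_eq hα, contested_mul hs]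
  field_simp

lemma spendB_mul (hs : 0 < s) (hα : 0 < α) :
    spendB (s * α) (s * β) (s * p) = s * spendB α β p := by
  rw [spendB_eq (mul_pos hs hα), spendB_eq hα, contested_mul hs]
  field_simp

lemma winProbA_mul (hs : 0 < s) (hα : 0 < α) (hβ : 0 < β) :
    winProbA (s * α) (s * β) (s * p) = winProbA α β p := by
  rw [eq_add_of_sub_eq (winProbA_sub_spendA_div (mul_pos hs hα) (mul_pos hs hβ)),
    eq_add_of_sub_eq (winProbA_sub_spendA_div hα hβ), spendA_mul hs hα, contested_mul hs,
    mul_div_mul_left _ _ hs.ne', mul_div_mul_left _ _ hs.ne']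

end contested

/-! ### Equilibrium of the second stage -/

section secondStage

variable {w τ p : Fin n → ℝ} {RA RB κA κB v : ℝ} {F FA FB : Measure (Fin n → ℝ)}

lemma exists_hasMarginals_marginalA (hw : ∀ b, 0 < w b) (hp : ∀ b, 0 ≤ p b) (hA : 0 < κA)
    (hB : 0 < κB) : ∃ F, HasMarginals F fun b => marginalA (w b * κA) (w b * κB) (p b) :=
  exists_hasMarginals fun b =>
    cdf_equilibriumLawA (mul_pos (hw b) hA) (mul_pos (hw b) hB) (hp b)

lemma exists_hasMarginals_marginalB (hw : ∀ b, 0 < w b) (hp : ∀ b, 0 ≤ p b) (hA : 0 < κA) :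
    ∃ F, HasMarginals F fun b => marginalB (w b * κA) (w b * κB) (p b) :=
  exists_hasMarginals fun b => cdf_equilibriumLawB (mul_pos (hw b) hA) (hp b)

lemma HasMarginals.marginal_eq_equilibriumLawA (hw : ∀ b, 0 < w b) (hp : ∀ b, 0 ≤ p b)
    (hA : 0 < κA) (hB : 0 < κB)
    (hF : HasMarginals F fun b => marginalA (w b * κA) (w b * κB) (p b)) (b : Fin n) :
    marginal F b = equilibriumLawA (w b * κA) (w b * κB) (p b) :=
  hF.marginal_eq (cdf_equilibriumLawA (mul_pos (hw b) hA) (mul_pos (hw b) hB) (hp b))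

lemma HasMarginals.marginal_eq_equilibriumLawB (hw : ∀ b, 0 < w b) (hp : ∀ b, 0 ≤ p b)
    (hA : 0 < κA) (hF : HasMarginals F fun b => marginalB (w b * κA) (w b * κB) (p b))
    (b : Fin n) : marginal F b = equilibriumLawB (w b * κA) (w b * κB) (p b) :=
  hF.marginal_eq (cdf_equilibriumLawB (mul_pos (hw b) hA) (hp b))

lemma IsKappa.isStrategyA (hκ : IsKappa w p RA RB κA κB) (hw : ∀ b, 0 < w b)
    (hp : ∀ b, 0 ≤ p b) (hF : HasMarginals F fun b => marginalA (w b * κA) (w b * κB) (p b)) :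
    IsStrategy RA F := by
  have := hF.isProbabilityMeasure
  have hα b : 0 < w b * κA := mul_pos (hw b) hκ.posA
  have hβ b : 0 < w b * κB := mul_pos (hw b) hκ.posB
  refine isStrategy_of_marginal_eq_rampLaw
    (hF.marginal_eq_equilibriumLawA hw hp hκ.posA hκ.posB)
    (fun b => div_nonneg (contested_nonneg (hα b)) (hβ b).le)
    (fun b => contested_div_right_le_one (hβ b) (hp b)) (fun _ => le_rfl) (fun b => (hβ b).le)
    (hκ.eqA ▸ Finset.sum_le_sum fun b _ => le_of_eq ?_)
  have := (hβ b).ne'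
  rw [spendA_eq (hα b), mul_zero, zero_add, div_pow]
  field_simp

lemma IsKappa.isStrategyB (hκ : IsKappa w p RA RB κA κB) (hw : ∀ b, 0 < w b)
    (hp : ∀ b, 0 ≤ p b) (hF : HasMarginals F fun b => marginalB (w b * κA) (w b * κB) (p b)) :
    IsStrategy RB F := by
  have := hF.isProbabilityMeasure
  have hα b : 0 < w b * κA := mul_pos (hw b) hκ.posA
  refine isStrategy_of_marginal_eq_rampLaw (hF.marginal_eq_equilibriumLawB hw hp hκ.posA)
    (fun b => div_nonneg (contested_nonneg (hα b)) (hα b).le)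
    (fun b => contested_div_left_le_one (hα b)) hp (fun b => (hα b).le)
    (hκ.eqB ▸ Finset.sum_le_sum fun b _ => le_of_eq ?_)
  have := (hα b).ne'
  rw [spendB_eq (hα b), div_pow]
  field_simp
  ring

lemma IsKappa.value_le_payoffA (hκ : IsKappa w p RA RB κA κB) (hw : ∀ b, 0 < w b)
    (hτ : ∀ b, 0 ≤ τ b) (hp : ∀ b, 0 ≤ p b) (hRB : 0 ≤ RB)
    (hFA : HasMarginals FA fun b => marginalA (w b * κA) (w b * κB) (p b))
    (hFB : IsStrategy RB FB) :
    ∑ b, w b * winProbA (w b * κA) (w b * κB) (p b) ≤ payoffA w τ p FA FB := by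
  have := hFA.isProbabilityMeasure
  have hα b : 0 < w b * κA := mul_pos (hw b) hκ.posA
  have hβ b : 0 < w b * κB := mul_pos (hw b) hκ.posB
  calc ∑ b, w b * winProbA (w b * κA) (w b * κB) (p b)
      = ∑ b, w b * min 1 ((w b * κA + p b) / (w b * κB)) - RB / κB := by
        rw [← hκ.eqB, Finset.sum_div, ← Finset.sum_sub_distrib]
        refine Finset.sum_congr rfl fun b _ => ?_
        rw [← winProbA_add_spendB_div (hα b) (hβ b), mul_add, ← mul_div_assoc,
          mul_div_mul_left _ _ (hw b).ne', add_sub_cancel_right]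
    _ ≤ payoffA w τ p FA FB := by
        refine sum_sub_div_le_payoffA hw hτ hκ.posB hRB hFB fun b y hy => ?_
        rw [hFA.marginal_eq_equilibriumLawA hw hp hκ.posA hκ.posB]
        exact sub_div_le_equilibriumLawA_real_Ioi (hβ b) (hp b) hy

lemma IsKappa.payoffA_le_value (hκ : IsKappa w p RA RB κA κB) (hw : ∀ b, 0 < w b)
    (hτ : ∀ b, τ b ≤ 1) (hp : ∀ b, 0 ≤ p b) (hRA : 0 ≤ RA)
    (hFB : HasMarginals FB fun b => marginalB (w b * κA) (w b * κB) (p b))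
    (hFA : IsStrategy RA FA) :
    payoffA w τ p FA FB ≤ ∑ b, w b * winProbA (w b * κA) (w b * κB) (p b) := by
  have := hFB.isProbabilityMeasure
  have hα b : 0 < w b * κA := mul_pos (hw b) hκ.posA
  have hβ b : 0 < w b * κB := mul_pos (hw b) hκ.posB
  calc payoffA w τ p FA FB
      ≤ ∑ b, w b * (1 - contested (w b * κA) (w b * κB) (p b) / (w b * κA)) + RA / κA := by
        refine payoffA_le_sum_add_div hw hτ hκ.posA hRA hFA fun b x hx => ?_
        rw [hFB.marginal_eq_equilibriumLawB hw hp hκ.posA]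
        exact equilibriumLawB_real_Iic_le (hα b) (hp b) hx
    _ = ∑ b, w b * winProbA (w b * κA) (w b * κB) (p b) := by
        rw [← hκ.eqA, Finset.sum_div, ← Finset.sum_add_distrib]
        refine Finset.sum_congr rfl fun b _ => ?_
        rw [← winProbA_sub_spendA_div (hα b) (hβ b), mul_sub, ← mul_div_assoc (w b),
          mul_div_mul_left _ _ (hw b).ne', sub_add_cancel]

lemma IsKappa.isNash (hκ : IsKappa w p RA RB κA κB) (hw : ∀ b, 0 < w b)
    (hτ : ∀ b, 0 ≤ τ b ∧ τ b ≤ 1) (hp : ∀ b, 0 ≤ p b) (hRA : 0 ≤ RA) (hRB : 0 ≤ RB)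
    (hFA : HasMarginals FA fun b => marginalA (w b * κA) (w b * κB) (p b))
    (hFB : HasMarginals FB fun b => marginalB (w b * κA) (w b * κB) (p b)) :
    IsNash w τ p RA RB FA FB := by
  have hlow {GB} (hGB : IsStrategy RB GB) :=
    hκ.value_le_payoffA hw (fun b => (hτ b).1) hp hRB hFA hGB
  have hupp {GA} (hGA : IsStrategy RA GA) :=
    hκ.payoffA_le_value hw (fun b => (hτ b).2) hp hRA hFB hGA
  have hA := hκ.isStrategyA hw hp hFA
  have hB := hκ.isStrategyB hw hp hFB
  exact ⟨hA, hB, fun GA hGA => (hupp hGA).trans (hlow hB),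
    fun GB hGB => sub_le_sub_left ((hupp hA).trans (hlow hGB)) 1⟩

lemma IsNash.le_payoffA_of_guarantee (h : IsNash w τ p RA RB FA FB)
    (hv : ∃ GA, IsStrategy RA GA ∧ ∀ GB, IsStrategy RB GB → v ≤ payoffA w τ p GA GB) :
    v ≤ payoffA w τ p FA FB := by
  obtain ⟨GA, hGA, hv⟩ := hv
  exact (hv FB h.strategyB).trans (h.optimalA GA hGA)

lemma IsNash.payoffA_le_of_guarantee (h : IsNash w τ p RA RB FA FB)
    (hv : ∃ GB, IsStrategy RB GB ∧ ∀ GA, IsStrategy RA GA → payoffA w τ p GA GB ≤ v) :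
    payoffA w τ p FA FB ≤ v := by
  obtain ⟨GB, hGB, hv⟩ := hv
  exact (sub_le_sub_iff_left 1).1 (h.optimalB GB hGB) |>.trans (hv FA h.strategyA)

lemma IsNash.payoffA_eq (h : IsNash w τ p RA RB FA FB) (hκ : IsKappa w p RA RB κA κB)
    (hw : ∀ b, 0 < w b) (hτ : ∀ b, 0 ≤ τ b ∧ τ b ≤ 1) (hp : ∀ b, 0 ≤ p b) (hRA : 0 ≤ RA)
    (hRB : 0 ≤ RB) : payoffA w τ p FA FB = ∑ b, w b * winProbA (w b * κA) (w b * κB) (p b) := by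
  obtain ⟨GA, hGA⟩ := exists_hasMarginals_marginalA hw hp hκ.posA hκ.posB
  obtain ⟨GB, hGB⟩ := exists_hasMarginals_marginalB (κB := κB) hw hp hκ.posA
  exact le_antisymm
    (h.payoffA_le_of_guarantee ⟨GB, hκ.isStrategyB hw hp hGB, fun _ hG =>
      hκ.payoffA_le_value hw (fun b => (hτ b).2) hp hRA hGB hG⟩)
    (h.le_payoffA_of_guarantee ⟨GA, hκ.isStrategyA hw hp hGA, fun _ hG =>
      hκ.value_le_payoffA hw (fun b => (hτ b).1) hp hRB hGA hG⟩)

end secondStage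

/-! ### Closed forms of `κ_A` and `κ_B` -/

section closedForm

lemma eq_closed_form_of_budget_eqs {W₁ W₂ N C₁ C₂ x y : ℝ} (hW₁ : 0 ≤ W₁) (hW₂ : 0 ≤ W₂)
    (hx : 0 < x) (hy : 0 < y) (h₁ : C₁ * y - C₂ * x = N)
    (h₂ : W₁ * y ^ 2 + W₂ * x ^ 2 = C₁ * y + C₂ * x) (hD : 0 < W₁ * C₂ ^ 2 + W₂ * C₁ ^ 2) :
    x = (C₂ * (C₁ ^ 2 - W₁ * N) + C₁ * √((C₁ ^ 2 - W₁ * N) * (C₂ ^ 2 + W₂ * N))) /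
        (W₁ * C₂ ^ 2 + W₂ * C₁ ^ 2) := by
  have ratio : (C₁ ^ 2 - W₁ * N) * y ^ 2 = (C₂ ^ 2 + W₂ * N) * x ^ 2 := by
    rw [← h₁]
    linear_combination (-(C₁ * y - C₂ * x)) * h₂
  have key : (W₁ * C₂ ^ 2 + W₂ * C₁ ^ 2) * x ^ 2 = (C₁ ^ 2 - W₁ * N) * (C₁ * y + C₂ * x) := by
    rw [← h₁]
    linear_combination C₁ ^ 2 * h₂
  have hH₁ : 0 ≤ C₁ ^ 2 - W₁ * N :=
    (pos_of_mul_pos_left ((mul_pos hD (pow_pos hx 2)).trans_eq key)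
      (by rw [← h₂]; positivity)).le
  have hsqrt : √((C₁ ^ 2 - W₁ * N) * (C₂ ^ 2 + W₂ * N)) = (C₁ ^ 2 - W₁ * N) * y / x := by
    have hsq : (C₁ ^ 2 - W₁ * N) * (C₂ ^ 2 + W₂ * N) = ((C₁ ^ 2 - W₁ * N) * y / x) ^ 2 := by
      rw [div_pow, eq_div_iff (by positivity)]
      linear_combination -(C₁ ^ 2 - W₁ * N) * ratio
    rw [hsq, Real.sqrt_sq (by positivity)]
  rw [hsqrt, eq_div_iff hD.ne']
  field_simp
  linear_combination key

variable {w p : Fin n → ℝ} {RA RB κA κB : ℝ}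

lemma sum_types (hA : ∀ b, 0 ≤ w b * κA) (f g : Fin n → ℝ) :
    ∑ b, (if w b * κB ≤ p b then 0 else if w b * κB - p b ≤ w b * κA then f b else g b) =
      ∑ b ∈ type1 w p κA κB, f b + ∑ b ∈ type2 w p κA κB, g b := by
  rw [type1, type2, Finset.sum_filter, Finset.sum_filter, ← Finset.sum_add_distrib]
  refine Finset.sum_congr rfl fun b _ => ?_
  have := hA b
  split_ifs <;> grind

lemma IsKappa.budgetA (h : IsKappa w p RA RB κA κB) (hw : ∀ b, 0 < w b) :
    (∑ b ∈ type1 w p κA κB, w b) * κB ^ 2 + ∑ b ∈ type1 w p κA κB, p b ^ 2 / w b +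
      (∑ b ∈ type2 w p κA κB, w b) * κA ^ 2 =
        2 * cOne p RA (type1 w p κA κB) * κB := by
  have hB := h.posB
  have hspend := h.eqA
  simp only [spendA] at hspend
  rw [sum_types fun b => (mul_pos (hw b) h.posA).le] at hspend
  have h1 : ∑ b ∈ type1 w p κA κB, (w b * κB - p b) ^ 2 / (2 * (w b * κB)) =
      ((∑ b ∈ type1 w p κA κB, w b) * κB ^ 2 + ∑ b ∈ type1 w p κA κB, p b ^ 2 / w b) / (2 * κB) -
        ∑ b ∈ type1 w p κA κB, p b := by
    rw [Finset.sum_mul, ← Finset.sum_add_distrib, Finset.sum_div, ← Finset.sum_sub_distrib]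
    refine Finset.sum_congr rfl fun b _ => ?_
    have := hw b
    field_simp
    ring
  have h2 : ∑ b ∈ type2 w p κA κB, (w b * κA) ^ 2 / (2 * (w b * κB)) =
      (∑ b ∈ type2 w p κA κB, w b) * κA ^ 2 / (2 * κB) := by
    rw [Finset.sum_mul, Finset.sum_div]
    refine Finset.sum_congr rfl fun b _ => ?_
    have := hw b
    field_simp
  rw [h1, h2] at hspend
  rw [cOne, ← hspend]
  field_simp
  ring

lemma IsKappa.budgetB (h : IsKappa w p RA RB κA κB) (hw : ∀ b, 0 < w b) :
    (∑ b ∈ type1 w p κA κB, w b) * κB ^ 2 - ∑ b ∈ type1 w p κA κB, p b ^ 2 / w b +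
      (∑ b ∈ type2 w p κA κB, w b) * κA ^ 2 =
        2 * cTwo p RB (type2 w p κA κB) * κA := by
  have hA := h.posA
  have hspend := h.eqB
  simp only [spendB] at hspend
  rw [sum_types fun b => (mul_pos (hw b) hA).le] at hspend
  have h1 : ∑ b ∈ type1 w p κA κB, ((w b * κB) ^ 2 - p b ^ 2) / (2 * (w b * κA)) =
      ((∑ b ∈ type1 w p κA κB, w b) * κB ^ 2 - ∑ b ∈ type1 w p κA κB, p b ^ 2 / w b) /
        (2 * κA) := by
    rw [Finset.sum_mul, ← Finset.sum_sub_distrib, Finset.sum_div]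
    refine Finset.sum_congr rfl fun b _ => ?_
    have := hw b
    field_simp
  have h2 : ∑ b ∈ type2 w p κA κB, ((w b * κA + p b) ^ 2 - p b ^ 2) / (2 * (w b * κA)) =
      (∑ b ∈ type2 w p κA κB, w b) * κA ^ 2 / (2 * κA) + ∑ b ∈ type2 w p κA κB, p b := by
    rw [Finset.sum_mul, Finset.sum_div, ← Finset.sum_add_distrib]
    refine Finset.sum_congr rfl fun b _ => ?_
    have := hw b
    field_simp
    ring
  rw [h1, h2] at hspend
  rw [cTwo, ← hspend]
  field_simp
  ring

lemma IsKappa.kappaDenom_pos (h : IsKappa w p RA RB κA κB) (hw : ∀ b, 0 < w b)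
    (hp : ∀ b, 0 ≤ p b) (hRA : 0 < RA) (hRB : RB ≠ 0) :
    0 < kappaDenom w p RA RB (type1 w p κA κB) (type2 w p κA κB) := by
  have hA := h.posA
  have hW (s : Finset (Fin n)) : 0 ≤ ∑ b ∈ s, w b := Finset.sum_nonneg fun b _ => (hw b).le
  have hC₁ : 0 < cOne p RA (type1 w p κA κB) :=
    add_pos_of_pos_of_nonneg hRA (Finset.sum_nonneg fun b _ => hp b)
  have hW₁ := hW (type1 w p κA κB)
  have hW₂ := hW (type2 w p κA κB)
  rw [kappaDenom]
  obtain h₂ | h₂ := (type2 w p κA κB).eq_empty_or_nonempty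
  · obtain h₁ | h₁ := (type1 w p κA κB).eq_empty_or_nonempty
    · have hbudget := h.budgetB hw
      simp [h₁, h₂, cTwo, hA.ne', hRB] at hbudget
    · have := Finset.sum_pos (fun b _ => hw b) h₁
      have hC₂ : cTwo p RB (type2 w p κA κB) = RB := by simp [cTwo, h₂]
      rw [hC₂]
      positivity
  · have := Finset.sum_pos (fun b _ => hw b) h₂
    positivity

lemma IsKappa.eq_kappaA_and_eq_kappaB (h : IsKappa w p RA RB κA κB) (hw : ∀ b, 0 < w b)
    (hp : ∀ b, 0 ≤ p b) (hRA : 0 < RA) (hRB : RB ≠ 0) :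
    κA = kappaA w p RA RB (type1 w p κA κB) (type2 w p κA κB) ∧
      κB = kappaB w p RA RB (type1 w p κA κB) (type2 w p κA κB) := by
  have hD := h.kappaDenom_pos hw hp hRA hRB
  have hbudgetA := h.budgetA hw
  have hbudgetB := h.budgetB hw
  have hW (s : Finset (Fin n)) : 0 ≤ ∑ b ∈ s, w b := Finset.sum_nonneg fun b _ => (hw b).le
  rw [kappaDenom] at hD
  rw [kappaA, kappaB, kappaDenom, hOne, hTwo]
  refine ⟨eq_closed_form_of_budget_eqs (hW _) (hW _) h.posA h.posB (by linarith) (by linarith)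
    hD, ?_⟩
  -- The two equations are symmetric under swapping the indices `1` and `2` and negating `N`.
  have := eq_closed_form_of_budget_eqs (hW _) (hW _) h.posB h.posA
    (N := -∑ b ∈ type1 w p κA κB, p b ^ 2 / w b) (C₂ := cOne p RA (type1 w p κA κB))
    (C₁ := cTwo p RB (type2 w p κA κB)) (W₁ := ∑ b ∈ type2 w p κA κB, w b)
    (W₂ := ∑ b ∈ type1 w p κA κB, w b) (by linarith) (by linarith) (by linarith)
  simpa only [mul_neg, sub_neg_eq_add, ← sub_eq_add_neg, mul_comm (cTwo _ _ _ ^ 2 + _),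
    add_comm (_ * cOne _ _ _ ^ 2)] using this

end closedForm

/-! ### Existence of `κ_A` and `κ_B` -/

section monotoneRoots

lemma exists_pos_eq_mul_of_antitone {f : ℝ → ℝ} {R : ℝ} (hf : Antitone f) (hfc : Continuous f)
    (hf0 : 0 < f 0) (hR : 0 < R) : ∃ u, 0 < u ∧ f u = R * u := by
  have hM : 0 < f 0 / R := div_pos hf0 hR
  obtain ⟨u, hu, hroot⟩ := intermediate_value_Icc' hM.le
    (f := fun u => f u - R * u) (by fun_prop) (show (0 : ℝ) ∈ Set.Icc _ _ from
      ⟨by rw [mul_div_cancel₀ _ hR.ne']; exact sub_nonpos.2 (hf hM.le), by simpa using hf0.le⟩)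
  refine ⟨u, hu.1.lt_of_ne ?_, sub_eq_zero.1 hroot⟩
  rintro rfl
  simp [hf0.ne'] at hroot

lemma strictAnti_sub_mul_of_antitone {f : ℝ → ℝ} {R : ℝ} (hf : Antitone f) (hR : 0 < R) :
    StrictAnti fun u => f u - R * u := fun u v huv => by
  linarith only [hf huv.le, mul_lt_mul_of_pos_left huv hR]

lemma continuousOn_of_forall_strictAnti {X α β : Type*} [TopologicalSpace X] [LinearOrder α]
    [TopologicalSpace α] [OrderTopology α] [LinearOrder β] [TopologicalSpace β]
    [OrderClosedTopology β] {g : X → α → β} {U : X → α} {s : Set X} {c : β}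
    (hg : ∀ u, ContinuousOn (fun x => g x u) s) (hanti : ∀ x ∈ s, StrictAnti (g x))
    (hU : ∀ x ∈ s, g x (U x) = c) : ContinuousOn U s := by
  have hlt {x} (hx : x ∈ s) (u : α) : u < U x ↔ c < g x u := by
    rw [← hU x hx, (hanti x hx).lt_iff_gt]
  have hgt {x} (hx : x ∈ s) (u : α) : U x < u ↔ g x u < c := by
    rw [← hU x hx, (hanti x hx).lt_iff_gt]
  intro x hx
  refine tendsto_order.2 ⟨fun a ha => ?_, fun a ha => ?_⟩
  · filter_upwards [(hg a x hx).eventually_const_lt ((hlt hx a).1 ha), self_mem_nhdsWithin]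
      with y hy hys using (hlt hys a).2 hy
  · filter_upwards [(hg a x hx).eventually_lt_const ((hgt hx a).1 ha), self_mem_nhdsWithin]
      with y hy hys using (hgt hys a).2 hy

end monotoneRoots

section spending

variable {α β p : ℝ}

lemma continuousOn_spendA {X : Type*} [TopologicalSpace X] {s : Set X} {f g : X → ℝ} (β : ℝ)
    (hf : ContinuousOn f s) (hg : ContinuousOn g s) (hpos : ∀ x ∈ s, 0 < f x) :
    ContinuousOn (fun x => spendA (f x) β (g x)) s := by
  refine ContinuousOn.congr ?_ fun x hx => spendA_eq (hpos x hx)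
  unfold contested
  fun_prop

lemma continuousOn_spendB {X : Type*} [TopologicalSpace X] {s : Set X} {f g : X → ℝ} (β : ℝ)
    (hf : ContinuousOn f s) (hg : ContinuousOn g s) (hpos : ∀ x ∈ s, 0 < f x) :
    ContinuousOn (fun x => spendB (f x) β (g x)) s := by
  refine ContinuousOn.congr ?_ fun x hx => spendB_eq (hpos x hx)
  unfold contested
  exact ContinuousOn.div (by fun_prop) (by fun_prop) fun x hx =>
    mul_ne_zero two_ne_zero (hpos x hx).ne'

lemma antitone_spendA (hα : 0 < α) (hβ : 0 < β) : Antitone (spendA α β) := fun p q hpq => by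
  rw [spendA_eq hα, spendA_eq hα]
  gcongr
  · exact contested_nonneg hα
  · unfold contested
    gcongr

lemma spendA_zero_pos (hα : 0 < α) (hβ : 0 < β) : 0 < spendA α β 0 := by
  have : 0 < contested α β 0 := by simp [contested, hα, hβ]
  rw [spendA_eq hα]
  positivity

lemma mul_spendA_le_mul_spendB (hα : 0 < α) (hβ : 0 < β) (hp : 0 ≤ p) :
    β * spendA α β p ≤ α * spendB α β p := by
  have := mul_nonneg (contested_nonneg (β := β) (p := p) hα) hp
  rw [spendA_eq hα, spendB_eq hα]
  field_simp
  linarith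

lemma spendA_eq_of_le (hβα : β ≤ α) (hp : 0 ≤ p) : spendA α β p = spendA β β p := by
  simp only [spendA, (by linarith : β - p ≤ α), (by linarith : β - p ≤ β), if_true]

lemma mul_spendB_le (hα : 0 < α) (hβα : β ≤ α) (hp : 0 ≤ p) :
    α * spendB α β p ≤ β ^ 2 / 2 := by
  rw [spendB, if_pos (by linarith : β - p ≤ α)]
  split_ifs
  · rw [mul_zero]
    positivity
  · field_simp
    linarith [sq_nonneg p]

end spending

section existence

variable {w p : Fin n → ℝ} {RA RB : ℝ}

lemma antitone_sum_spendA (hw : ∀ b, 0 < w b) (hp : ∀ b, 0 ≤ p b) {ρ : ℝ} (hρ : 0 < ρ) :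
    Antitone fun u => ∑ b, spendA (w b * ρ) (w b) (p b * u) := fun _ _ huv =>
  Finset.sum_le_sum fun b _ => antitone_spendA (mul_pos (hw b) hρ) (hw b)
    (mul_le_mul_of_nonneg_left huv (hp b))

lemma exists_pos_sum_spendA_eq [NeZero n] (hw : ∀ b, 0 < w b) (hp : ∀ b, 0 ≤ p b)
    (hRA : 0 < RA) {ρ : ℝ} (hρ : 0 < ρ) :
    ∃ u, 0 < u ∧ ∑ b, spendA (w b * ρ) (w b) (p b * u) = RA * u := by
  refine exists_pos_eq_mul_of_antitone (antitone_sum_spendA hw hp hρ) ?_ ?_ hRA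
  · exact continuous_finsetSum _ fun b _ => continuousOn_univ.1 <| continuousOn_spendA _
      continuousOn_const (by fun_prop) fun _ _ => mul_pos (hw b) hρ
  · simp only [mul_zero]
    exact Finset.sum_pos (fun b _ => spendA_zero_pos (mul_pos (hw b) hρ) (hw b))
      Finset.univ_nonempty

lemma exists_continuousOn_sum_spendA_eq [NeZero n] (hw : ∀ b, 0 < w b) (hp : ∀ b, 0 ≤ p b)
    (hRA : 0 < RA) : ∃ U : ℝ → ℝ, ContinuousOn U (Set.Ioi 0) ∧ ∀ ρ > 0, 0 < U ρ ∧
      ∀ u, ∑ b, spendA (w b * ρ) (w b) (p b * u) = RA * u ↔ u = U ρ := by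
  have hroot (ρ : Set.Ioi (0 : ℝ)) := exists_pos_sum_spendA_eq hw hp hRA ρ.2
  choose! U hU using fun ρ hρ => hroot ⟨ρ, hρ⟩
  have hanti (ρ : ℝ) (hρ : 0 < ρ) :=
    strictAnti_sub_mul_of_antitone (antitone_sum_spendA hw hp hρ) hRA
  have hU0 (ρ : ℝ) (hρ : 0 < ρ) := sub_eq_zero.2 (hU ρ hρ).2
  refine ⟨U, continuousOn_of_forall_strictAnti (fun u => ?_) hanti hU0, fun ρ hρ =>
    ⟨(hU ρ hρ).1, fun u => ⟨fun hu => ?_, fun hu => hu ▸ (hU ρ hρ).2⟩⟩⟩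
  · refine ContinuousOn.sub (continuousOn_finsetSum _ fun b _ => ?_) continuousOn_const
    exact continuousOn_spendA _ (by fun_prop) continuousOn_const fun ρ hρ => mul_pos (hw b) hρ
  · exact (hanti ρ hρ).injective ((sub_eq_zero.2 hu).trans (hU0 ρ hρ).symm)

lemma sum_spendA_le_mul_sum_spendB (hw : ∀ b, 0 < w b) (hp : ∀ b, 0 ≤ p b) {ρ : ℝ}
    (hρ : 0 < ρ) :
    ∑ b, spendA (w b * ρ) (w b) (p b) ≤ ρ * ∑ b, spendB (w b * ρ) (w b) (p b) := by
  rw [Finset.mul_sum]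
  refine Finset.sum_le_sum fun b _ => ?_
  rw [← mul_le_mul_iff_right₀ (hw b), ← mul_assoc]
  exact mul_spendA_le_mul_spendB (mul_pos (hw b) hρ) (hw b) (hp b)

lemma mul_sum_spendB_le (hw : ∀ b, 0 < w b) (hp : ∀ b, 0 ≤ p b) {ρ : ℝ} (hρ : 1 ≤ ρ) :
    ρ * ∑ b, spendB (w b * ρ) (w b) (p b) ≤ ∑ b, w b / 2 := by
  rw [Finset.mul_sum]
  refine Finset.sum_le_sum fun b _ => ?_
  rw [← mul_le_mul_iff_right₀ (hw b), ← mul_assoc]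
  linarith only [mul_spendB_le (mul_pos (hw b) (one_pos.trans_le hρ))
    (le_mul_of_one_le_right (hw b).le hρ) (hp b)]

lemma sum_spendA_eq_of_one_le (hw : ∀ b, 0 < w b) (hp : ∀ b, 0 ≤ p b) {ρ : ℝ} (hρ : 1 ≤ ρ) :
    ∑ b, spendA (w b * ρ) (w b) (p b) = ∑ b, spendA (w b * 1) (w b) (p b) :=
  Finset.sum_congr rfl fun b _ => by
    rw [spendA_eq_of_le (le_mul_of_one_le_right (hw b).le hρ) (hp b), mul_one]

/-- With `ρ = κ_A / κ_B` and `u = 1 / κ_B` the first equation determines `u` as a continuous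
function of `ρ`; along it `B` spends too much at `ρ = R_A / R_B` and too little for large `ρ`. -/
lemma exists_sum_spendA_eq_and_sum_spendB_eq [NeZero n] (hw : ∀ b, 0 < w b)
    (hp : ∀ b, 0 ≤ p b) (hRA : 0 < RA) (hRB : 0 < RB) :
    ∃ ρ > 0, ∃ u > 0, ∑ b, spendA (w b * ρ) (w b) (p b * u) = RA * u ∧
      ∑ b, spendB (w b * ρ) (w b) (p b * u) = RB * u := by
  obtain ⟨U, hUc, hU⟩ := exists_continuousOn_sum_spendA_eq hw hp hRA
  have hspend {ρ : ℝ} (hρ : 0 < ρ) := ((hU ρ hρ).2 _).2 rfl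
  have hpU {ρ : ℝ} (hρ : 0 < ρ) (b) := mul_nonneg (hp b) (hU ρ hρ).1.le
  have hρ₀ : 0 < RA / RB := div_pos hRA hRB
  have hcont : ContinuousOn (fun ρ => ∑ b, spendB (w b * ρ) (w b) (p b * U ρ) - RB * U ρ)
      (Set.Ioi 0) := by
    refine ContinuousOn.sub (continuousOn_finsetSum _ fun b _ => ?_) (continuousOn_const.mul hUc)
    exact continuousOn_spendB _ (by fun_prop) (continuousOn_const.mul hUc)
      fun ρ hρ => mul_pos (hw b) hρ
  have hlow : 0 ≤ ∑ b, spendB (w b * (RA / RB)) (w b) (p b * U (RA / RB)) - RB * U (RA / RB) := by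
    rw [sub_nonneg, ← mul_le_mul_iff_right₀ hρ₀, ← mul_assoc, div_mul_cancel₀ _ hRB.ne',
      ← hspend hρ₀]
    exact sum_spendA_le_mul_sum_spendB hw (hpU hρ₀) hρ₀
  have hhigh {ρ : ℝ} (hρ1 : 1 ≤ ρ) (hρ : (∑ b, w b / 2) / (RB * U 1) ≤ ρ) :
      ∑ b, spendB (w b * ρ) (w b) (p b * U ρ) - RB * U ρ ≤ 0 := by
    have hρ0 : 0 < ρ := one_pos.trans_le hρ1
    have hUρ : U 1 = U ρ := by
      rw [← (hU ρ hρ0).2, ← hspend one_pos, sum_spendA_eq_of_one_le hw (hpU one_pos) hρ1]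
    rw [← hUρ, sub_nonpos, ← mul_le_mul_iff_right₀ hρ0]
    exact (mul_sum_spendB_le hw (hpU one_pos) hρ1).trans
      ((div_le_iff₀ (mul_pos hRB (hU 1 one_pos).1)).1 hρ)
  obtain ⟨ρ, hρ, hroot⟩ := intermediate_value_Icc' (le_max_left (RA / RB) _)
    (hcont.mono fun ρ hρ => hρ₀.trans_le hρ.1)
    ⟨hhigh ((le_max_left _ _).trans (le_max_right _ _))
      ((le_max_right _ _).trans (le_max_right _ _)), hlow⟩
  have hρ0 : 0 < ρ := hρ₀.trans_le hρ.1
  exact ⟨ρ, hρ0, U ρ, (hU ρ hρ0).1, hspend hρ0, sub_eq_zero.1 hroot⟩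

lemma exists_isKappa [NeZero n] (hw : ∀ b, 0 < w b) (hp : ∀ b, 0 ≤ p b) (hRA : 0 < RA)
    (hRB : 0 < RB) : ∃ κA κB, IsKappa w p RA RB κA κB := by
  obtain ⟨ρ, hρ, u, hu, hA, hB⟩ := exists_sum_spendA_eq_and_sum_spendB_eq hw hp hRA hRB
  have hα (b) : w b * (u⁻¹ * ρ) = u⁻¹ * (w b * ρ) := mul_left_comm _ _ _
  have hβ (b) : w b * u⁻¹ = u⁻¹ * w b := mul_comm _ _
  have hpu (b) : p b = u⁻¹ * (p b * u) := by field_simp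
  refine ⟨u⁻¹ * ρ, u⁻¹, by positivity, by positivity, ?_, ?_⟩
  · calc ∑ b, spendA (w b * (u⁻¹ * ρ)) (w b * u⁻¹) (p b)
        = ∑ b, u⁻¹ * spendA (w b * ρ) (w b) (p b * u) := Finset.sum_congr rfl fun b _ => by
          rw [hα, hβ, ← spendA_mul (inv_pos.2 hu) (mul_pos (hw b) hρ), ← hpu]
      _ = RA := by rw [← Finset.mul_sum, hA]; field_simp
  · calc ∑ b, spendB (w b * (u⁻¹ * ρ)) (w b * u⁻¹) (p b)
        = ∑ b, u⁻¹ * spendB (w b * ρ) (w b) (p b * u) := Finset.sum_congr rfl fun b _ => by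
          rw [hα, hβ, ← spendB_mul (inv_pos.2 hu) (mul_pos (hw b) hρ), ← hpu]
      _ = RB := by rw [← Finset.mul_sum, hB]; field_simp

end existence

/-! ### Guarantees in the two-stage game -/

section spePayoff

variable {P x y : ℝ}

lemma add_sqrt_eq_sub (hP : 0 ≤ P) (hPy : P < y) :
    (y - P) ^ 2 / (2 * y) + √((y - P) ^ 2 / (2 * y) * ((y - P) ^ 2 / (2 * y) + 2 * P)) =
      y - P := by
  have hy : 0 < y := hP.trans_lt hPy
  have hsq : (y - P) ^ 2 / (2 * y) * ((y - P) ^ 2 / (2 * y) + 2 * P) =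
      ((y - P) * (y + P) / (2 * y)) ^ 2 := by
    field_simp
    ring
  rw [hsq, Real.sqrt_sq (div_nonneg (mul_nonneg (by linarith) (by linarith)) (by positivity))]
  field_simp
  ring

lemma two_mul_sq_div_le_of_two_mul_le {d m : ℝ} (hP : 0 ≤ P) (hd : 0 < d) (hdm : 2 * d ≤ m) :
    2 * d ^ 2 / (P + 2 * d) ≤ m ^ 2 / (2 * (P + m)) := by
  have hm : 0 < m := by linarith
  rw [div_le_div_iff₀ (by positivity) (by positivity)]
  calc 2 * d ^ 2 * (2 * (P + m)) = (2 * d) ^ 2 * P + 2 * d * m * (2 * d) := by ring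
    _ ≤ m ^ 2 * P + 2 * d * m * m := by gcongr
    _ = m ^ 2 * (P + 2 * d) := by ring

lemma spePayoff_of_type1 (hP : 0 ≤ P) (hx : 0 < x) (hPy : P < y) (hyx : y - P ≤ x) :
    spePayoff P ((y - P) ^ 2 / (2 * y)) ((y ^ 2 - P ^ 2) / (2 * x)) =
      1 - (y ^ 2 - P ^ 2) / (2 * x * y) := by
  have hy : 0 < y := hP.trans_lt hPy
  have hm : 0 < y - P := sub_pos.2 hPy
  have hexcess : 2 * ((y ^ 2 - P ^ 2) / (2 * x) - P) ≤ y - P := by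
    have : (y ^ 2 - P ^ 2) / (2 * x) ≤ (y + P) / 2 := by
      rw [div_le_div_iff₀ (by positivity) two_pos]
      calc (y ^ 2 - P ^ 2) * 2 = 2 * (y + P) * (y - P) := by ring
        _ ≤ 2 * (y + P) * x := by gcongr
        _ = (y + P) * (2 * x) := by ring
    linarith only [this]
  rw [spePayoff, if_neg (by positivity), if_pos, add_assoc P, add_sqrt_eq_sub hP hPy,
    add_sub_cancel]
  · field_simp
  · rcases le_or_gt ((y ^ 2 - P ^ 2) / (2 * x)) P with h | h
    · exact .inl h
    · simpa using Or.inr (a := _ ≤ P) (two_mul_sq_div_le_of_two_mul_le hP (sub_pos.2 h) hexcess)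

lemma spePayoff_of_type2 (hP : 0 ≤ P) (hx : 0 < x) (hxy : x < y - P) :
    spePayoff P (x ^ 2 / (2 * y)) (((x + P) ^ 2 - P ^ 2) / (2 * x)) = x / (2 * y) := by
  have hy : 0 < y := by linarith
  have hRB : ((x + P) ^ 2 - P ^ 2) / (2 * x) = P + x / 2 := by
    field_simp
    ring
  rw [spePayoff, hRB, add_sub_cancel_left, mul_div_cancel₀ _ two_ne_zero, if_neg (by positivity),
    if_neg]
  · field_simp
  · have hlt : x ^ 2 / (2 * y) < x ^ 2 / (2 * (P + x)) := by
      gcongr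
      linarith
    have hthreshold : 2 * (x / 2) ^ 2 / (P + x) = x ^ 2 / (2 * (P + x)) := by
      field_simp
    push Not
    exact ⟨by linarith, hthreshold ▸ hlt⟩

lemma spePayoff_spendA_spendB (hP : 0 ≤ P) (hx : 0 < x) (hPy : P < y) :
    spePayoff P (spendA x y P) (spendB x y P) = winProbA x y P := by
  unfold spendA spendB winProbA
  simp only [if_neg hPy.not_ge]
  split_ifs with h
  · exact spePayoff_of_type1 hP hx hPy h
  · exact spePayoff_of_type2 hP hx (not_le.1 h)

end spePayoff

section proportional

variable {w : Fin n → ℝ} {P RA RB κA κB : ℝ}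

lemma neZero_of_sum_eq_one (hw1 : ∑ b, w b = 1) : NeZero n :=
  ⟨by rintro rfl; simp at hw1⟩

lemma proportional_mem_preallocations (hw : ∀ b, 0 < w b) (hw1 : ∑ b, w b = 1) (hP : 0 ≤ P) :
    (fun b => P * w b) ∈ preallocations n P :=
  ⟨fun b => mul_nonneg hP (hw b).le, by rw [← Finset.mul_sum, hw1, mul_one]⟩

lemma sum_spendA_proportional (hw : ∀ b, 0 < w b) (hw1 : ∑ b, w b = 1) (hA : 0 < κA) :
    ∑ b, spendA (w b * κA) (w b * κB) (P * w b) = spendA κA κB P := by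
  simp only [mul_comm P, spendA_mul (hw _) hA, ← Finset.sum_mul, hw1, one_mul]

lemma sum_spendB_proportional (hw : ∀ b, 0 < w b) (hw1 : ∑ b, w b = 1) (hA : 0 < κA) :
    ∑ b, spendB (w b * κA) (w b * κB) (P * w b) = spendB κA κB P := by
  simp only [mul_comm P, spendB_mul (hw _) hA, ← Finset.sum_mul, hw1, one_mul]

lemma sum_mul_winProbA_proportional (hw : ∀ b, 0 < w b) (hw1 : ∑ b, w b = 1) (hA : 0 < κA)
    (hB : 0 < κB) :
    ∑ b, w b * winProbA (w b * κA) (w b * κB) (P * w b) = winProbA κA κB P := by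
  simp only [mul_comm P, winProbA_mul (hw _) hA hB, ← Finset.sum_mul, hw1, one_mul]

/-- After the proportional pre-allocation the battlefields are scaled copies of a single one. -/
lemma IsKappa.spendA_eq_and_spendB_eq_and_winProbA_eq
    (h : IsKappa w (fun b => P * w b) RA RB κA κB) (hw : ∀ b, 0 < w b) (hw1 : ∑ b, w b = 1)
    (hP : 0 ≤ P) (hRA : 0 < RA) :
    spendA κA κB P = RA ∧ spendB κA κB P = RB ∧ winProbA κA κB P = spePayoff P RA RB := by
  have hA := (sum_spendA_proportional hw hw1 h.posA).symm.trans h.eqA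
  have hB := (sum_spendB_proportional hw hw1 h.posA).symm.trans h.eqB
  have hPB : P < κB := by
    by_contra! hle
    exact hRA.ne (hA.symm.trans (if_pos hle)).symm
  exact ⟨hA, hB, by rw [← hA, ← hB, spePayoff_spendA_spendB hP h.posA hPB]⟩

end proportional

section guarantees

variable {w τ p : Fin n → ℝ} {P RA RB κ r ε : ℝ} {FB : Measure (Fin n → ℝ)}

lemma exists_isStrategy_marginal_eq_rampLaw {c p γ : Fin n → ℝ} {R : ℝ} (hc : ∀ b, 0 ≤ c b)
    (hc1 : ∀ b, c b ≤ 1) (hp : ∀ b, 0 ≤ p b) (hγ : ∀ b, 0 ≤ γ b)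
    (hR : ∑ b, (c b * p b + c b ^ 2 * γ b / 2) ≤ R) :
    ∃ F, IsStrategy R F ∧ ∀ b, marginal F b = rampLaw (c b) (p b) (γ b) :=
  ⟨Measure.pi fun b => rampLaw (c b) (p b) (γ b),
    isStrategy_of_marginal_eq_rampLaw (marginal_pi _) hc hc1 hp hγ hR, marginal_pi _⟩

/-- The cost of the ramp law `rampLaw r (p b) (w b * κ)` depends on `p` only through `∑ b, p b`. -/
lemma exists_forall_payoffA_le_one_sub_add (hw : ∀ b, 0 < w b) (hw1 : ∑ b, w b = 1)
    (hτ : ∀ b, τ b ≤ 1) (hp : p ∈ preallocations n P) (hr : 0 ≤ r) (hr1 : r ≤ 1) (hκ : 0 < κ)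
    (hcost : r * P + r ^ 2 * κ / 2 ≤ RB) (hRA : 0 ≤ RA) :
    ∃ FB, IsStrategy RB FB ∧ ∀ FA, IsStrategy RA FA →
      payoffA w τ p FA FB ≤ 1 - r + RA / κ := by
  have hγ (b) : 0 < w b * κ := mul_pos (hw b) hκ
  obtain ⟨FB, hFB, hmarg⟩ := exists_isStrategy_marginal_eq_rampLaw (c := fun _ => r) (R := RB)
    (fun _ => hr) (fun _ => hr1) hp.1 (fun b => (hγ b).le) <| by
      rwa [Finset.sum_add_distrib, ← Finset.mul_sum, hp.2, ← Finset.sum_div, ← Finset.mul_sum,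
        ← Finset.sum_mul, hw1, one_mul]
  have := hFB.isProbabilityMeasure
  refine ⟨FB, hFB, fun FA hFA => ?_⟩
  calc payoffA w τ p FA FB ≤ ∑ b, w b * (1 - r) + RA / κ :=
        payoffA_le_sum_add_div hw hτ hκ hRA hFA fun b x hx => by
          rw [hmarg]
          exact rampLaw_real_Iic_le hr1 (hp.1 b) (hγ b) hx
    _ = 1 - r + RA / κ := by rw [← Finset.sum_mul, hw1, one_mul]

lemma exists_forall_payoffA_le_spePayoff (hw : ∀ b, 0 < w b) (hw1 : ∑ b, w b = 1)
    (hτ : ∀ b, τ b ≤ 1) (hP : 0 ≤ P) (hRA : 0 < RA) (hRB : 0 < RB)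
    (hp : p ∈ preallocations n P) :
    ∃ FB, IsStrategy RB FB ∧ ∀ FA, IsStrategy RA FA →
      payoffA w τ p FA FB ≤ spePayoff P RA RB := by
  have := neZero_of_sum_eq_one hw1
  obtain ⟨κA, κB, hκ⟩ :=
    exists_isKappa hw (proportional_mem_preallocations hw hw1 hP).1 hRA hRB
  obtain ⟨hA, hB, hwin⟩ := hκ.spendA_eq_and_spendB_eq_and_winProbA_eq hw hw1 hP hRA
  have hvalue := winProbA_sub_spendA_div (p := P) hκ.posA hκ.posB
  rw [hA, hwin, sub_eq_iff_eq_add] at hvalue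
  rw [hvalue]
  refine exists_forall_payoffA_le_one_sub_add hw hw1 hτ hp
    (div_nonneg (contested_nonneg hκ.posA) hκ.posA.le) (contested_div_left_le_one hκ.posA)
    hκ.posA ?_ hRA.le
  have := hκ.posA.ne'
  refine le_of_eq ?_
  rw [← hB, spendB_eq hκ.posA]
  field_simp
  ring

lemma exists_forall_payoffA_le_one_sub_of_mul_lt (hw : ∀ b, 0 < w b) (hw1 : ∑ b, w b = 1)
    (hτ : ∀ b, τ b ≤ 1) (hp : p ∈ preallocations n P) (hr : 0 ≤ r) (hr1 : r ≤ 1)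
    (hrP : r * P < RB) :
    ∃ FB, IsStrategy RB FB ∧ ∀ FA, IsStrategy 0 FA → payoffA w τ p FA FB ≤ 1 - r := by
  have hκ : 0 < RB - r * P := sub_pos.2 hrP
  have hcost : r * P + r ^ 2 * (2 * (RB - r * P)) / 2 ≤ RB := by
    linarith only [mul_le_of_le_one_left hκ.le (pow_le_one₀ (n := 2) hr hr1)]
  simpa only [zero_div, add_zero] using
    exists_forall_payoffA_le_one_sub_add hw hw1 hτ hp hr hr1 (by positivity) hcost le_rfl

lemma spePayoff_zero_of_lt (h : P < RB) : spePayoff P 0 RB = 0 := by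
  simp [spePayoff, h.le]

lemma spePayoff_zero_of_le (hRB : 0 < RB) (h : RB ≤ P) : spePayoff P 0 RB = 1 - RB / P := by
  rcases h.eq_or_lt with rfl | h
  · simp [spePayoff, hRB.ne']
  · simp [spePayoff, h.not_ge]

lemma exists_forall_payoffA_le_spePayoff_zero_add (hw : ∀ b, 0 < w b) (hw1 : ∑ b, w b = 1)
    (hτ : ∀ b, τ b ≤ 1) (hRB : 0 < RB) (hp : p ∈ preallocations n P) (hε : 0 < ε) :
    ∃ FB, IsStrategy RB FB ∧ ∀ FA, IsStrategy 0 FA →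
      payoffA w τ p FA FB ≤ spePayoff P 0 RB + ε := by
  suffices ∃ r, 0 ≤ r ∧ r ≤ 1 ∧ r * P < RB ∧ 1 - r ≤ spePayoff P 0 RB + ε by
    obtain ⟨r, hr, hr1, hrP, hle⟩ := this
    obtain ⟨FB, hFB, h⟩ := exists_forall_payoffA_le_one_sub_of_mul_lt hw hw1 hτ hp hr hr1 hrP
    exact ⟨FB, hFB, fun FA hFA => (h FA hFA).trans hle⟩
  rcases lt_or_ge P RB with hlt | hge
  · exact ⟨1, zero_le_one, le_rfl, by rwa [one_mul], by simp [spePayoff_zero_of_lt hlt, hε.le]⟩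
  · have hP : 0 < P := hRB.trans_le hge
    have hratio : 0 < RB / P := div_pos hRB hP
    have hr : max 0 (RB / P - ε) < RB / P := max_lt hratio (sub_lt_self _ hε)
    refine ⟨max 0 (RB / P - ε), le_max_left _ _, hr.le.trans ((div_le_one hP).2 hge),
      (lt_div_iff₀ hP).1 hr, ?_⟩
    rw [spePayoff_zero_of_le hRB hge]
    linarith only [le_max_right 0 (RB / P - ε)]

lemma isStrategy_dirac_zero (R : ℝ) : IsStrategy R (Measure.dirac (0 : Fin n → ℝ)) := by
  refine ⟨inferInstance, ?_, ?_⟩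
  · rw [ae_dirac_eq]
    exact fun _ => le_rfl
  · simp [lintegral_dirac]

lemma marginal_dirac_zero (b : Fin n) : marginal (Measure.dirac 0) b = Measure.dirac 0 :=
  Measure.map_dirac' (measurable_pi_apply b) 0

lemma spePayoff_zero_le_payoffA_dirac_zero (hw : ∀ b, 0 < w b) (hw1 : ∑ b, w b = 1)
    (hτ : ∀ b, 0 ≤ τ b) (hRB : 0 < RB) (hFB : IsStrategy RB FB) :
    spePayoff P 0 RB ≤ payoffA w τ (fun b => P * w b) (Measure.dirac 0) FB := by
  rcases lt_or_ge P RB with hlt | hge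
  · exact (spePayoff_zero_of_lt hlt).trans_le (payoffA_nonneg (fun b => (hw b).le) hτ)
  have hP : 0 < P := hRB.trans_le hge
  calc spePayoff P 0 RB = ∑ b, w b * 1 - RB / P := by
        rw [spePayoff_zero_of_le hRB hge, ← Finset.sum_mul, hw1, one_mul]
    _ ≤ _ := sum_sub_div_le_payoffA hw hτ hP hRB.le hFB fun b y hy => ?_
  rw [marginal_dirac_zero, measureReal_def, Measure.dirac_apply' _ measurableSet_Ioi]
  rcases lt_or_ge y (P * w b) with hy' | hy'
  · simpa [hy'] using div_nonneg hy (mul_pos (hw b) hP).le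
  · simpa [hy'.not_gt] using (one_le_div (mul_pos (hw b) hP)).2 (mul_comm P _ ▸ hy')

end guarantees

/-! ### Second-stage equilibria when `A` has no real-time resources -/

section noResources

variable {w τ p r : Fin n → ℝ} {RB : ℝ} {F FB : Measure (Fin n → ℝ)}

lemma eq_dirac_zero_of_isStrategy_zero (h : IsStrategy 0 F) : F = Measure.dirac 0 := by
  have := h.isProbabilityMeasure
  have hsum : ∫⁻ x, ENNReal.ofReal (∑ b, x b) ∂F = 0 := by
    simpa using h.budget
  rw [lintegral_eq_zero_iff (by fun_prop)] at hsum
  have hae : id =ᵐ[F] fun _ => 0 := by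
    filter_upwards [hsum, h.nonneg] with x hx hnonneg
    have hx0 : ∑ b, x b = 0 := le_antisymm (by simpa using hx)
      (Finset.sum_nonneg fun b _ => hnonneg b)
    exact funext fun b =>
      (Finset.sum_eq_zero_iff_of_nonneg fun b _ => hnonneg b).1 hx0 b (Finset.mem_univ b)
  rw [← Measure.map_id (μ := F), Measure.map_congr hae, Measure.map_const, measure_univ, one_smul]

lemma isNash_dirac_zero (hFB : IsStrategy RB FB)
    (h : ∀ GB, IsStrategy RB GB →
      payoffA w τ p (Measure.dirac 0) FB ≤ payoffA w τ p (Measure.dirac 0) GB) :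
    IsNash w τ p 0 RB (Measure.dirac 0) FB :=
  ⟨isStrategy_dirac_zero 0, hFB, fun GA hGA => by rw [eq_dirac_zero_of_isStrategy_zero hGA],
    fun GB hGB => sub_le_sub_left (h GB hGB) 1⟩

lemma payoffA_zero_dirac_zero [IsProbabilityMeasure FB] :
    payoffA w 0 p (Measure.dirac 0) FB =
      ∑ b, w b * (1 - (marginal FB b).real (Set.Ici (p b))) := by
  simp only [payoffA_eq_sum_expectedShare, marginal_dirac_zero, Pi.zero_apply,
    expectedShare_dirac_zero]

lemma IsStrategy.sum_mul_marginal_real_Ici_le (h : IsStrategy RB F) (hRB : 0 ≤ RB) :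
    ∑ b, p b * (marginal F b).real (Set.Ici (p b)) ≤ RB :=
  (Finset.sum_le_sum fun b _ => mul_meas_ge_le_integral_of_nonneg (h.marginal_nonneg b)
    (h.integrable_marginal b) (p b)).trans (h.sum_integral_marginal_le hRB)

lemma exists_isStrategy_le_marginal_real_Ici (hp : ∀ b, 0 ≤ p b) (hr : r ∈ Set.Icc 0 1)
    (hcost : ∑ b, p b * r b ≤ RB) :
    ∃ F, IsStrategy RB F ∧ ∀ b, r b ≤ (marginal F b).real (Set.Ici (p b)) := by
  obtain ⟨F, hF, hmarg⟩ := exists_isStrategy_marginal_eq_rampLaw (γ := 0) hr.1 hr.2 hp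
    (fun _ => le_rfl) (by simpa [mul_comm (r _)] using hcost)
  exact ⟨F, hF, fun b => hmarg b ▸ le_rampLaw_real_Ici (hr.2 b) le_rfl⟩

/-- Only the probabilities `r b` of reaching `p b` matter to `B`, who faces a fractional knapsack
problem with values `w b` and weights `p b`. -/
lemma exists_isNash_zero_dirac_zero (hw : ∀ b, 0 < w b) (hp : ∀ b, 0 ≤ p b) (hRB : 0 ≤ RB) :
    ∃ FB, IsNash w 0 p 0 RB (Measure.dirac 0) FB := by
  let knapsack : Set (Fin n → ℝ) := Set.Icc 0 1 ∩ {r | ∑ b, p b * r b ≤ RB}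
  have hcompact : IsCompact knapsack :=
    isCompact_Icc.inter_right (isClosed_le (by fun_prop) continuous_const)
  have hne : knapsack.Nonempty := ⟨0, ⟨le_rfl, zero_le_one⟩, by simpa using hRB⟩
  obtain ⟨r, ⟨hr, hcost⟩, hmax⟩ :=
    hcompact.exists_isMaxOn (f := fun r => ∑ b, w b * r b) hne (by fun_prop)
  obtain ⟨FB, hFB, hreach⟩ := exists_isStrategy_le_marginal_real_Ici hp hr hcost
  refine ⟨FB, isNash_dirac_zero hFB fun GB hGB => ?_⟩
  have := hFB.isProbabilityMeasure
  have := hGB.isProbabilityMeasure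
  rw [payoffA_zero_dirac_zero, payoffA_zero_dirac_zero]
  simp only [mul_sub, Finset.sum_sub_distrib]
  refine sub_le_sub_left ?_ _
  calc ∑ b, w b * (marginal GB b).real (Set.Ici (p b)) ≤ ∑ b, w b * r b :=
        hmax ⟨⟨fun _ => measureReal_nonneg, fun _ => measureReal_le_one⟩,
          hGB.sum_mul_marginal_real_Ici_le hRB⟩
    _ ≤ ∑ b, w b * (marginal FB b).real (Set.Ici (p b)) :=
        Finset.sum_le_sum fun b _ => mul_le_mul_of_nonneg_left (hreach b) (hw b).le

end noResources

/-! ### Subgame-perfect equilibria -/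

section twoStage

variable {w τ : Fin n → ℝ} {P RA RB : ℝ}

lemma exists_forall_spePayoff_le_payoffA (hw : ∀ b, 0 < w b) (hw1 : ∑ b, w b = 1)
    (hτ : ∀ b, 0 ≤ τ b) (hP : 0 ≤ P) (hRA : 0 ≤ RA) (hRB : 0 < RB) :
    ∃ FA, IsStrategy RA FA ∧ ∀ FB, IsStrategy RB FB →
      spePayoff P RA RB ≤ payoffA w τ (fun b => P * w b) FA FB := by
  rcases hRA.eq_or_lt with rfl | hRA
  · exact ⟨_, isStrategy_dirac_zero 0, fun FB =>
      spePayoff_zero_le_payoffA_dirac_zero hw hw1 hτ hRB⟩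
  · have := neZero_of_sum_eq_one hw1
    have hp := (proportional_mem_preallocations hw hw1 hP).1
    obtain ⟨κA, κB, hκ⟩ := exists_isKappa hw hp hRA hRB
    obtain ⟨FA, hFA⟩ := exists_hasMarginals_marginalA hw hp hκ.posA hκ.posB
    refine ⟨FA, hκ.isStrategyA hw hp hFA, fun FB hFB => ?_⟩
    rw [← (hκ.spendA_eq_and_spendB_eq_and_winProbA_eq hw hw1 hP hRA).2.2,
      ← sum_mul_winProbA_proportional hw hw1 hκ.posA hκ.posB]
    exact hκ.value_le_payoffA hw hτ hp hRB.le hFA hFB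

lemma exists_forall_payoffA_le_spePayoff_add (hw : ∀ b, 0 < w b) (hw1 : ∑ b, w b = 1)
    (hτ : ∀ b, τ b ≤ 1) (hP : 0 ≤ P) (hRA : 0 ≤ RA) (hRB : 0 < RB)
    {p : Fin n → ℝ} (hp : p ∈ preallocations n P) {ε : ℝ} (hε : 0 < ε) :
    ∃ FB, IsStrategy RB FB ∧ ∀ FA, IsStrategy RA FA →
      payoffA w τ p FA FB ≤ spePayoff P RA RB + ε := by
  rcases hRA.eq_or_lt with rfl | hRA
  · exact exists_forall_payoffA_le_spePayoff_zero_add hw hw1 hτ hRB hp hε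
  · obtain ⟨FB, hFB, h⟩ := exists_forall_payoffA_le_spePayoff hw hw1 hτ hP hRA hRB hp
    exact ⟨FB, hFB, fun FA hFA => le_add_of_le_of_nonneg (h FA hFA) hε.le⟩

lemma exists_isNash (hw : ∀ b, 0 < w b) (hw1 : ∑ b, w b = 1)
    (hτ : ∀ b, 0 ≤ τ b ∧ τ b ≤ 1) (hRA : 0 ≤ RA) (hRB : 0 < RB)
    (h : 0 < RA ∨ P < RB ∨ ∀ b, τ b = 0) {p : Fin n → ℝ} (hp : p ∈ preallocations n P) :
    ∃ FA FB, IsNash w τ p RA RB FA FB := by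
  rcases hRA.eq_or_lt with rfl | hRA
  · rcases h with h | h | h
    · exact absurd h (lt_irrefl 0)
    · obtain ⟨FB, hFB, hle⟩ := exists_forall_payoffA_le_one_sub_of_mul_lt hw hw1
        (fun b => (hτ b).2) hp zero_le_one le_rfl (by rwa [one_mul])
      rw [sub_self] at hle
      exact ⟨_, FB, isNash_dirac_zero hFB fun GB _ => (hle _ (isStrategy_dirac_zero 0)).trans
        (payoffA_nonneg (fun b => (hw b).le) fun b => (hτ b).1)⟩
    · obtain rfl : τ = 0 := funext h
      exact ⟨_, exists_isNash_zero_dirac_zero hw hp.1 hRB.le⟩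
  · have := neZero_of_sum_eq_one hw1
    obtain ⟨κA, κB, hκ⟩ := exists_isKappa hw hp.1 hRA hRB
    obtain ⟨FA, hFA⟩ := exists_hasMarginals_marginalA hw hp.1 hκ.posA hκ.posB
    obtain ⟨FB, hFB⟩ := exists_hasMarginals_marginalB (κB := κB) hw hp.1 hκ.posA
    exact ⟨FA, FB, hκ.isNash hw hτ hp.1 hRA.le hRB.le hFA hFB⟩

lemma IsNash.spePayoff_le_payoffA {FA FB : Measure (Fin n → ℝ)}
    (h : IsNash w τ (fun b => P * w b) RA RB FA FB) (hw : ∀ b, 0 < w b) (hw1 : ∑ b, w b = 1)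
    (hτ : ∀ b, 0 ≤ τ b) (hP : 0 ≤ P) (hRA : 0 ≤ RA) (hRB : 0 < RB) :
    spePayoff P RA RB ≤ payoffA w τ (fun b => P * w b) FA FB :=
  h.le_payoffA_of_guarantee (exists_forall_spePayoff_le_payoffA hw hw1 hτ hP hRA hRB)

lemma IsNash.payoffA_le_spePayoff {FA FB : Measure (Fin n → ℝ)} {p : Fin n → ℝ}
    (h : IsNash w τ p RA RB FA FB) (hp : p ∈ preallocations n P) (hw : ∀ b, 0 < w b)
    (hw1 : ∑ b, w b = 1) (hτ : ∀ b, τ b ≤ 1) (hP : 0 ≤ P) (hRA : 0 ≤ RA) (hRB : 0 < RB) :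
    payoffA w τ p FA FB ≤ spePayoff P RA RB :=
  le_of_forall_pos_le_add fun _ hε => h.payoffA_le_of_guarantee
    (exists_forall_payoffA_le_spePayoff_add hw hw1 hτ hP hRA hRB hp hε)

lemma isSPE_proportional (hw : ∀ b, 0 < w b) (hw1 : ∑ b, w b = 1)
    (hτ : ∀ b, 0 ≤ τ b ∧ τ b ≤ 1) (hP : 0 ≤ P) (hRA : 0 ≤ RA) (hRB : 0 < RB)
    {FA FB : (Fin n → ℝ) → Measure (Fin n → ℝ)}
    (h : ∀ p ∈ preallocations n P, IsNash w τ p RA RB (FA p) (FB p)) :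
    IsSPE w τ P RA RB (fun b => P * w b) FA FB :=
  have hmem := proportional_mem_preallocations hw hw1 hP
  ⟨hmem, h, fun p hp =>
    ((h p hp).payoffA_le_spePayoff hp hw hw1 (fun b => (hτ b).2) hP hRA hRB).trans
      ((h _ hmem).spePayoff_le_payoffA hw hw1 (fun b => (hτ b).1) hP hRA hRB)⟩

lemma IsSPE.payoffA_eq {pstar : Fin n → ℝ}
    {FA FB : (Fin n → ℝ) → Measure (Fin n → ℝ)} (h : IsSPE w τ P RA RB pstar FA FB)
    (hw : ∀ b, 0 < w b) (hw1 : ∑ b, w b = 1) (hτ : ∀ b, 0 ≤ τ b ∧ τ b ≤ 1) (hP : 0 ≤ P)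
    (hRA : 0 ≤ RA) (hRB : 0 < RB) :
    payoffA w τ pstar (FA pstar) (FB pstar) = spePayoff P RA RB :=
  have hmem := proportional_mem_preallocations hw hw1 hP
  le_antisymm
    ((h.nash _ h.feasible).payoffA_le_spePayoff h.feasible hw hw1 (fun b => (hτ b).2) hP hRA hRB)
    (((h.nash _ hmem).spePayoff_le_payoffA hw hw1 (fun b => (hτ b).1) hP hRA hRB).trans
      (h.optimal _ hmem))

lemma exists_isSPE_proportional (hw : ∀ b, 0 < w b) (hw1 : ∑ b, w b = 1)
    (hτ : ∀ b, 0 ≤ τ b ∧ τ b ≤ 1) (hP : 0 ≤ P) (hRA : 0 ≤ RA) (hRB : 0 < RB)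
    (h : 0 < RA ∨ P < RB ∨ ∀ b, τ b = 0) :
    ∃ FA FB, IsSPE w τ P RA RB (fun b => P * w b) FA FB := by
  choose! FA FB hNash using fun p (hp : p ∈ preallocations n P) =>
    exists_isNash hw hw1 hτ hRA hRB h hp
  exact ⟨FA, FB, isSPE_proportional hw hw1 hτ hP hRA hRB hNash⟩

end twoStage

end Lotto

end

theorem mainTheorem1 {n : ℕ} (w : Fin n → ℝ) (hw : ∀ b, 0 < w b) (hw1 : ∑ b, w b = 1)
    (τ : Fin n → ℝ) (hτ : ∀ b, 0 ≤ τ b ∧ τ b ≤ 1) (RB : ℝ) (hRB : 0 < RB) :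
    -- the second stage, for an arbitrary nonnegative pre-allocation vector
    (∀ RA : ℝ, 0 < RA → ∀ p : Fin n → ℝ, (∀ b, 0 ≤ p b) →
      (∃ κA κB, Lotto.IsKappa w p RA RB κA κB) ∧
      ∀ κA κB, Lotto.IsKappa w p RA RB κA κB →
        (κA = Lotto.kappaA w p RA RB (Lotto.type1 w p κA κB) (Lotto.type2 w p κA κB) ∧
          κB = Lotto.kappaB w p RA RB (Lotto.type1 w p κA κB) (Lotto.type2 w p κA κB)) ∧
        (∃ FA, Lotto.HasMarginals FA
          (fun b => Lotto.marginalA (w b * κA) (w b * κB) (p b))) ∧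
        (∃ FB, Lotto.HasMarginals FB
          (fun b => Lotto.marginalB (w b * κA) (w b * κB) (p b))) ∧
        (∀ FA FB,
          Lotto.HasMarginals FA (fun b => Lotto.marginalA (w b * κA) (w b * κB) (p b)) →
          Lotto.HasMarginals FB (fun b => Lotto.marginalB (w b * κA) (w b * κB) (p b)) →
          Lotto.IsNash w τ p RA RB FA FB) ∧
        (∀ FA FB, Lotto.IsNash w τ p RA RB FA FB →
          Lotto.payoffA w τ p FA FB =
            ∑ b, w b * Lotto.winProbA (w b * κA) (w b * κB) (p b))) ∧
    -- the two-stage game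
    (∀ P RA : ℝ, 0 ≤ P → 0 ≤ RA →
      ((0 < RA ∨ P < RB ∨ ∀ b, τ b = 0) →
        ∃ FA FB, Lotto.IsSPE w τ P RA RB (fun b => P * w b) FA FB) ∧
      (∀ FA FB : (Fin n → ℝ) → MeasureTheory.Measure (Fin n → ℝ),
        (∀ p ∈ Lotto.preallocations n P, Lotto.IsNash w τ p RA RB (FA p) (FB p)) →
        Lotto.IsSPE w τ P RA RB (fun b => P * w b) FA FB) ∧
      (∀ pstar FA FB, Lotto.IsSPE w τ P RA RB pstar FA FB →
        Lotto.payoffA w τ pstar (FA pstar) (FB pstar) = Lotto.spePayoff P RA RB ∧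
        Lotto.payoffB w τ pstar (FA pstar) (FB pstar) = 1 - Lotto.spePayoff P RA RB) ∧
      (∃ FA, Lotto.IsStrategy RA FA ∧ ∀ FB, Lotto.IsStrategy RB FB →
        Lotto.spePayoff P RA RB ≤ Lotto.payoffA w τ (fun b => P * w b) FA FB) ∧
      (∀ p ∈ Lotto.preallocations n P, ∀ ε : ℝ, 0 < ε →
        ∃ FB, Lotto.IsStrategy RB FB ∧ ∀ FA, Lotto.IsStrategy RA FA →
          Lotto.payoffA w τ p FA FB ≤ Lotto.spePayoff P RA RB + ε)) := by
  have := Lotto.neZero_of_sum_eq_one hw1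
  refine ⟨fun RA hRA p hp => ⟨Lotto.exists_isKappa hw hp hRA hRB, fun κA κB hκ =>
    ⟨hκ.eq_kappaA_and_eq_kappaB hw hp hRA hRB.ne',
      Lotto.exists_hasMarginals_marginalA hw hp hκ.posA hκ.posB,
      Lotto.exists_hasMarginals_marginalB hw hp hκ.posA,
      fun FA FB => hκ.isNash hw hτ hp hRA.le hRB.le,
      fun FA FB hNash => hNash.payoffA_eq hκ hw hτ hp hRA.le hRB.le⟩⟩,
    fun P RA hP hRA => ⟨?_, ?_, ?_, ?_, ?_⟩⟩
  · exact Lotto.exists_isSPE_proportional hw hw1 hτ hP hRA hRB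
  · exact fun FA FB => Lotto.isSPE_proportional hw hw1 hτ hP hRA hRB
  · intro pstar FA FB hSPE
    have hA := hSPE.payoffA_eq hw hw1 hτ hP hRA hRB
    exact ⟨hA, congrArg (1 - ·) hA⟩
  · exact Lotto.exists_forall_spePayoff_le_payoffA hw hw1 (fun b => (hτ b).1) hP hRA hRB
  · exact fun p hp ε hε =>
      Lotto.exists_forall_payoffA_le_spePayoff_add hw hw1 (fun b => (hτ b).2) hP hRA hRB hp hε
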